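/- \textbf{Setting.} A finite probabilistic automaton is $\mathcal A=(S,\bar s,\Sigma,D)$ with $S$ finite, $\bar s\in S$, $\Sigma=H\uplus E$ (hidden and external actions), and $D\subseteq S\times\Sigma\times\mathrm{Disc}(S)$ finite, where $\mathrm{Disc}(S)$ is the set of probability distributions on $S$. Let $\mathcal R$ be an equivalence relation on $S$, $a\in\Sigma$, $\mu\in\mathrm{Disc}(S)$, $A\subseteq D$ a set of allowed transitions, and $t\in S$. A finite execution fragment is a sequence $\alpha=s_0a_1s_1\dots a_ns_n$ such that for each $i\ge 1$ some $(s_{i-1},a_i,\rho)\in D$ has $\rho(s_i)>0$; $\mathrm{last}(\alpha)=s_n$, and $\mathrm{trace}(\alpha)$ is its subsequence of external actions; $\mathrm{trace}(a)$ is the empty sequence $\epsilon$ if $a\in H$ and the one-element sequence $a$ if $a\in E$. A scheduler $\sigma$ maps each finite execution fragment $\alpha$ to a sub-probability distribution on the transitions in $D$ with source $\mathrm{last}(\alpha)$; $\sigma(\alpha)(\bot)$ is the missing mass. It is determinate if $\sigma(\alpha)$ depends only on $\mathrm{trace}(\alpha)$ and $\mathrm{last}(\alpha)$. For $s\in S$,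 the cone probabilities are $\mu_{\sigma,s}(C_{s})=1$, $\mu_{\sigma,s}(C_{s'})=0$ for a state $s'\ne s$, and $\mu_{\sigma,s}(C_{\alpha b v})=\mu_{\sigma,s}(C_\alpha)\sum_{(u,b,\rho)\in D}\sigma(\alpha)(u,b,\rho)\,\rho(v)$; further $\mu_{\sigma,s}(\alpha)=\mu_{\sigma,s}(C_\alpha)\,\sigma(\alpha)(\bot)$. The scheduler $\sigma$ induces the allowed weak combined transition $t\stackrel{a}{\Longrightarrow}_A\nu$, with $\nu\in\mathrm{Disc}(S)$, if finite execution fragments have total $\mu_{\sigma,t}$-probability $1$, every $\alpha$ with $\mu_{\sigma,t}(\alpha)>0$ has $\mathrm{trace}(\alpha)=\mathrm{trace}(a)$, for each $v\in S$ the probability of the set of finite execution fragments with last state $v$ is $\nu(v)$, and the support of each $\sigma(\alpha)$ is contained in $A$. We write $\mu\,\mathcal L(\mathcal R)\,\nu$ if there is $w:S\times S\to[0,1]$ with $w(x,y)>0\Rightarrow x\,\mathcal R\,y$, $\sum_y w(x,y)=\mu(x)$ and $\sum_x w(x,y)=\nu(y)$. \textbf{The LP problem.} Below, $v'$ ranges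 over the support of $\rho$ and $C$ over the classes $S/\mathcal R$. If $a\in E$, the network has vertices $\vartriangle,\blacktriangledown$, $v$ and $v_a$ for $v\in S$, $v^{tr}$ and $v^{tr}_a$ for $tr=(v,b,\rho)\in A$ with $b\in H\cup\{a\}$, and the classes $C$. Its arcs are $(\vartriangle,t)$; $(v_a,C)$ for $v\in C$, and $(C,\blacktriangledown)$; $(v,v^{tr})$, $(v^{tr},v')$, $(v_a,v^{tr}_a)$, $(v^{tr}_a,v'_a)$ for $tr=(v,b,\rho)\in A$ with $b\in H$; and $(v,v^{tr}_a)$, $(v^{tr}_a,v'_a)$ for $tr=(v,a,\rho)\in A$. If $a\in H$, the vertices are $\vartriangle,\blacktriangledown$, $v$, $v^{tr}$ for $tr=(v,b,\rho)\in A$ with $b\in H$, and the classes; the arcs are $(\vartriangle,t)$; $(v,C)$ for $v\in C$, and $(C,\blacktriangledown)$; and $(v,v^{tr})$, $(v^{tr},v')$ for $tr=(v,b,\rho)\in A$ with $b\in H$. The LP problem has a real variable $f_{x,y}$ for each arc $(x,y)$ and maximizes $\sum_{(x,y)}-f_{x,y}$ subject to: $f_{x,y}\ge 0$ for all arcs;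 $f_{\vartriangle,t}=1$; $f_{C,\blacktriangledown}=\mu(C)$ for every class $C$; at every vertex other than $\vartriangle,\blacktriangledown$ the total incoming flow equals the total outgoing flow; $f_{v^{tr},v'}=\rho(v')f_{v,v^{tr}}$ for $tr=(v,b,\rho)\in A$ with $b\in H$; and, if $a\in E$, also $f_{v^{tr}_a,v'_a}=\rho(v')f_{v_a,v^{tr}_a}$ for $tr=(v,b,\rho)\in A$ with $b\in H$, and $f_{v^{tr}_a,v'_a}=\rho(v')f_{v,v^{tr}_a}$ for $tr=(v,a,\rho)\in A$. \textbf{Theorem.} (1) The following are equivalent: (i) the LP problem has a feasible solution $f$ with $f_{C,\blacktriangledown}=\mu(C)$ for every $C\in S/\mathcal R$; (ii) the LP problem has an optimal solution $f$ with $f_{C,\blacktriangledown}=\mu(C)$ for every $C\in S/\mathcal R$; (iii) there are a scheduler $\sigma$ and $\mu_t\in\mathrm{Disc}(S)$ such that $\sigma$ induces $t\stackrel{a}{\Longrightarrow}_A\mu_t$ and $\mu\,\mathcal L(\mathcal R)\,\mu_t$. (2) Let $f$ be a feasible solution of the LP problem and let $\vec f_x$ be the total flow into a vertex $x$. For a finite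 execution fragment $\alpha$ with last state $v$ and $tr=(v,b,\rho)\in A$ put $\sigma(\alpha)(tr)=f_{v,v^{tr}}/\vec f_v$ if $\mathrm{trace}(\alpha)=\epsilon$, $b\in H$ and $\vec f_v\neq0$; $\sigma(\alpha)(tr)=f_{v,v^{tr}_a}/\vec f_v$ if $\mathrm{trace}(\alpha)=\epsilon$, $b=a\in E$ and $\vec f_v\ne0$; $\sigma(\alpha)(tr)=f_{v_a,v^{tr}_a}/\vec f_{v_a}$ if $\mathrm{trace}(\alpha)=a\in E$, $b\in H$ and $\vec f_{v_a}\neq0$; and put $\sigma(\alpha)(tr)=0$ for all other transitions $tr$ and in all other cases. Then $\sigma$ is a determinate scheduler that induces $t\stackrel{a}{\Longrightarrow}_A\mu_t$ with $\mu\,\mathcal L(\mathcal R)\,\mu_t$, where $\mu_t(v)$ is the flow on the arc from $v$ (if $a\in H$) or $v_a$ (if $a\in E$) to the class of $v$. -/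

import Mathlib

open scoped ENNReal

/-- A probabilistic transition `source --action--> target`. -/
structure PTransition (S Act : Type*) where
  source : S
  action : Act
  target : PMF S

/-- A probabilistic automaton with states `S` and actions `Act` and finitely many transitions.
The actions in `hidden` are the internal ones, all the others are external. -/
structure ProbAutomaton (S Act : Type*) where
  start : S
  hidden : Set Act
  trans : Finset (PTransition S Act)

/-- Finite alternating sequences `s₀ a₁ s₁ … aₙ sₙ` of states and actions. -/
inductive AltSeq (S Act : Type*) where
  | init (s : S) : AltSeq S Act
  | step (α : AltSeq S Act) (b : Act) (v : S) : AltSeq S Act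

/-- The last state of a finite alternating sequence. -/
def AltSeq.last {S Act : Type*} : AltSeq S Act → S
  | .init s => s
  | .step _ _ v => v

open Classical in
/-- The subsequence of external actions. -/
noncomputable def AltSeq.trace {S Act : Type*} (H : Set Act) : AltSeq S Act → List Act
  | .init _ => []
  | .step α b _ => if b ∈ H then α.trace H else α.trace H ++ [b]

open Classical in
/-- The trace of a single action: empty if it is hidden, the action itself if it is external. -/
noncomputable def actionTrace {Act : Type*} (H : Set Act) (a : Act) : List Act :=
  if a ∈ H then [] else [a]

namespace ProbAutomaton

variable {S Act : Type*}

/-- The sequence is an execution fragment: each step follows some transition with positive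
probability. -/
def IsFrag (M : ProbAutomaton S Act) : AltSeq S Act → Prop
  | .init _ => True
  | .step α b v => M.IsFrag α ∧
      ∃ tr ∈ M.trans, tr.source = α.last ∧ tr.action = b ∧ 0 < tr.target v

/-- Finite execution fragments. -/
abbrev FinFrag (M : ProbAutomaton S Act) := {α : AltSeq S Act // M.IsFrag α}

/-- A scheduler maps each finite execution fragment to a sub-probability distribution over the
transitions that leave its last state. -/
structure Scheduler (M : ProbAutomaton S Act) where
  prob : M.FinFrag → PTransition S Act → ℝ≥0∞
  enabled : ∀ α tr, prob α tr ≠ 0 → tr ∈ M.trans ∧ tr.source = α.1.last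
  sum_le_one : ∀ α, ∑ tr ∈ M.trans, prob α tr ≤ 1

namespace Scheduler

variable {M : ProbAutomaton S Act}

/-- The probability `σ(α)(⊥)` of choosing no transition after `α`. -/
noncomputable def stopProb (σ : M.Scheduler) (α : M.FinFrag) : ℝ≥0∞ :=
  1 - ∑ tr ∈ M.trans, σ.prob α tr

open Classical in
/-- The probability of the cone of a finite execution fragment, for the scheduler `σ` started
in the state `s`. -/
noncomputable def coneProb (σ : M.Scheduler) (s : S) :
    (α : AltSeq S Act) → M.IsFrag α → ℝ≥0∞
  | .init v, _ => if v = s then 1 else 0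
  | .step α b v, h => coneProb σ s α h.1 *
      ∑ tr ∈ M.trans with tr.action = b, σ.prob ⟨α, h.1⟩ tr * tr.target v

/-- The probability that the execution is exactly the finite execution fragment `α`. -/
noncomputable def fragProb (σ : M.Scheduler) (s : S) (α : M.FinFrag) : ℝ≥0∞ :=
  σ.coneProb s α.1 α.2 * σ.stopProb α

/-- The probability of a set of finite execution fragments. -/
noncomputable def setProb (σ : M.Scheduler) (s : S) (X : Set M.FinFrag) : ℝ≥0∞ :=
  ∑' α : X, σ.fragProb s α

/-- `σ` induces a weak combined transition from `s` to `ν` labeled by `a`. -/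
structure InducesWeak (σ : M.Scheduler) (s : S) (a : Act) (ν : PMF S) : Prop where
  prob_finite : σ.setProb s Set.univ = 1
  trace_eq : ∀ α : M.FinFrag, 0 < σ.fragProb s α → α.1.trace M.hidden = actionTrace M.hidden a
  last_eq : ∀ v : S, σ.setProb s {α | α.1.last = v} = ν v

/-- `σ` induces an allowed weak combined transition from `s` to `ν` labeled by `a`, respecting
the set `A` of allowed transitions. -/
def InducesAllowedWeak (σ : M.Scheduler) (A : Finset (PTransition S Act)) (s : S) (a : Act)
    (ν : PMF S) : Prop :=
  σ.InducesWeak s a ν ∧ ∀ (α : M.FinFrag) (tr : PTransition S Act), 0 < σ.prob α tr → tr ∈ A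

/-- The choice made by `σ` depends only on the trace and the last state of the fragment. -/
def Determinate (σ : M.Scheduler) : Prop :=
  ∀ α α' : M.FinFrag, α.1.trace M.hidden = α'.1.trace M.hidden → α.1.last = α'.1.last →
    σ.prob α = σ.prob α'

end Scheduler

end ProbAutomaton

/-- The lifting of a relation to probability distributions, through a weighting function. -/
def LiftRel {X Y : Type*} (r : X → Y → Prop) (μ : PMF X) (ν : PMF Y) : Prop :=
  ∃ w : X → Y → ℝ≥0∞, (∀ x y, w x y ≤ 1) ∧ (∀ x y, 0 < w x y → r x y) ∧
    (∀ x, ∑' y, w x y = μ x) ∧ (∀ y, ∑' x, w x y = ν y)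

/-- The vertices of the network graphs: the source, the sink, the states `v`, the transitions
`v^tr`, the copies `v_a` and `v^tr_a` of these, and the equivalence classes. -/
inductive NetVertex {S Act : Type*} (R : Setoid S) (A : Finset (PTransition S Act)) where
  | source : NetVertex R A
  | sink : NetVertex R A
  | state (v : S) : NetVertex R A
  | trans (tr : A) : NetVertex R A
  | stateA (v : S) : NetVertex R A
  | transA (tr : A) : NetVertex R A
  | cls (C : Quotient R) : NetVertex R A

/-- An auxiliary encoding that shows that there are finitely many vertices. -/
def NetVertex.code {S Act : Type*} {R : Setoid S} {A : Finset (PTransition S Act)} :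
    NetVertex R A → Bool ⊕ S ⊕ A ⊕ S ⊕ A ⊕ Quotient R
  | .source => .inl true
  | .sink => .inl false
  | .state v => .inr (.inl v)
  | .trans tr => .inr (.inr (.inl tr))
  | .stateA v => .inr (.inr (.inr (.inl v)))
  | .transA tr => .inr (.inr (.inr (.inr (.inl tr))))
  | .cls C => .inr (.inr (.inr (.inr (.inr C))))

theorem NetVertex.code_injective {S Act : Type*} {R : Setoid S}
    {A : Finset (PTransition S Act)} :
    Function.Injective (NetVertex.code : NetVertex R A → _) := by
  intro x y h
  cases x <;> cases y <;> simp_all [NetVertex.code]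

noncomputable instance NetVertex.instFintype {S Act : Type*} [Fintype S] {R : Setoid S}
    {A : Finset (PTransition S Act)} : Fintype (NetVertex R A) :=
  haveI : Finite (NetVertex R A) := Finite.of_injective _ NetVertex.code_injective
  Fintype.ofFinite _

namespace ProbAutomaton

variable {S Act : Type*}

/-- The vertex set of the network graph for the action `a`; the copies indexed by `a` are present
only if `a` is external. -/
def netVertices (M : ProbAutomaton S Act) (R : Setoid S) (A : Finset (PTransition S Act))
    (a : Act) : Set (NetVertex R A) :=
  {x | match x with
    | .source => True
    | .sink => True
    | .state _ => True
    | .trans tr => tr.1.action = a ∨ tr.1.action ∈ M.hidden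
    | .stateA _ => a ∉ M.hidden
    | .transA tr => a ∉ M.hidden ∧ (tr.1.action = a ∨ tr.1.action ∈ M.hidden)
    | .cls _ => True}

/-- The arcs of the network graph for the initial state `t` and the action `a`. -/
inductive NetArc (M : ProbAutomaton S Act) (R : Setoid S) (A : Finset (PTransition S Act))
    (t : S) (a : Act) : NetVertex R A → NetVertex R A → Prop where
  | source : NetArc M R A t a .source (.state t)
  | sink (C : Quotient R) : NetArc M R A t a (.cls C) .sink
  | stopHidden (v : S) : a ∈ M.hidden → NetArc M R A t a (.state v) (.cls (Quotient.mk R v))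
  | stopExternal (v : S) : a ∉ M.hidden →
      NetArc M R A t a (.stateA v) (.cls (Quotient.mk R v))
  | hiddenIn (tr : A) : tr.1.action ∈ M.hidden →
      NetArc M R A t a (.state tr.1.source) (.trans tr)
  | hiddenOut (tr : A) (v : S) : tr.1.action ∈ M.hidden → 0 < tr.1.target v →
      NetArc M R A t a (.trans tr) (.state v)
  | hiddenInA (tr : A) : a ∉ M.hidden → tr.1.action ∈ M.hidden →
      NetArc M R A t a (.stateA tr.1.source) (.transA tr)
  | hiddenOutA (tr : A) (v : S) : a ∉ M.hidden → tr.1.action ∈ M.hidden → 0 < tr.1.target v →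
      NetArc M R A t a (.transA tr) (.stateA v)
  | externalIn (tr : A) : a ∉ M.hidden → tr.1.action = a →
      NetArc M R A t a (.state tr.1.source) (.transA tr)
  | externalOut (tr : A) (v : S) : a ∉ M.hidden → tr.1.action = a → 0 < tr.1.target v →
      NetArc M R A t a (.transA tr) (.stateA v)

open Classical in
/-- The total flow that enters a vertex. -/
noncomputable def inflow [Fintype S] (M : ProbAutomaton S Act) (R : Setoid S)
    (A : Finset (PTransition S Act)) (t : S) (a : Act)
    (f : NetVertex R A → NetVertex R A → ℝ) (x : NetVertex R A) : ℝ :=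
  ∑ y : NetVertex R A with M.NetArc R A t a y x, f y x

open Classical in
/-- The total flow that leaves a vertex. -/
noncomputable def outflow [Fintype S] (M : ProbAutomaton S Act) (R : Setoid S)
    (A : Finset (PTransition S Act)) (t : S) (a : Act)
    (f : NetVertex R A → NetVertex R A → ℝ) (x : NetVertex R A) : ℝ :=
  ∑ y : NetVertex R A with M.NetArc R A t a x y, f x y

open Classical in
/-- The probability of an equivalence class. -/
noncomputable def classProb [Fintype S] {R : Setoid S} (μ : PMF S) (C : Quotient R) : ℝ :=
  ∑ v : S with Quotient.mk R v = C, (μ v).toReal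

/-- The constraints of the LP problem. Only the values of `f` on arcs matter: they are the
variables of the problem. -/
structure LPFeasible [Fintype S] (M : ProbAutomaton S Act) (R : Setoid S)
    (A : Finset (PTransition S Act)) (t : S) (a : Act) (μ : PMF S)
    (f : NetVertex R A → NetVertex R A → ℝ) : Prop where
  nonneg : ∀ x y, M.NetArc R A t a x y → 0 ≤ f x y
  source_eq : f .source (.state t) = 1
  class_eq : ∀ C : Quotient R, f (.cls C) .sink = classProb μ C
  conservation : ∀ x ∈ M.netVertices R A a, x ≠ .source → x ≠ .sink →
    M.inflow R A t a f x - M.outflow R A t a f x = 0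
  balance_hidden : ∀ (tr : A) (v : S), tr.1.action ∈ M.hidden → 0 < tr.1.target v →
    f (.trans tr) (.state v) - (tr.1.target v).toReal * f (.state tr.1.source) (.trans tr) = 0
  balance_hiddenA : a ∉ M.hidden → ∀ (tr : A) (v : S), tr.1.action ∈ M.hidden →
    0 < tr.1.target v →
    f (.transA tr) (.stateA v) - (tr.1.target v).toReal * f (.stateA tr.1.source) (.transA tr) = 0
  balance_external : a ∉ M.hidden → ∀ (tr : A) (v : S), tr.1.action = a →
    0 < tr.1.target v →
    f (.transA tr) (.stateA v) - (tr.1.target v).toReal * f (.state tr.1.source) (.transA tr) = 0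

open Classical in
/-- The objective function of the LP problem, to be maximized. -/
noncomputable def lpObjective [Fintype S] (M : ProbAutomaton S Act) (R : Setoid S)
    (A : Finset (PTransition S Act)) (t : S) (a : Act)
    (f : NetVertex R A → NetVertex R A → ℝ) : ℝ :=
  ∑ e : NetVertex R A × NetVertex R A with M.NetArc R A t a e.1 e.2, -f e.1 e.2

/-- Optimal solutions of the LP problem. -/
def LPOptimal [Fintype S] (M : ProbAutomaton S Act) (R : Setoid S)
    (A : Finset (PTransition S Act)) (t : S) (a : Act) (μ : PMF S)
    (f : NetVertex R A → NetVertex R A → ℝ) : Prop :=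
  M.LPFeasible R A t a μ f ∧
    ∀ g, M.LPFeasible R A t a μ g → M.lpObjective R A t a g ≤ M.lpObjective R A t a f

open Classical in
/-- The flow from a state to its class: it leaves `v` if `a` is hidden and `v_a` otherwise. -/
noncomputable def stopFlow (M : ProbAutomaton S Act) (R : Setoid S)
    (A : Finset (PTransition S Act)) (a : Act)
    (f : NetVertex R A → NetVertex R A → ℝ) (v : S) : ℝ :=
  if a ∈ M.hidden then f (.state v) (.cls (Quotient.mk R v))
  else f (.stateA v) (.cls (Quotient.mk R v))

open Classical in
/-- The probability with which the scheduler built from the flow `f` chooses `tr` after `α`: the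
share of the flow into the current vertex that is sent on to `tr`. It is `0` if that vertex
has no incoming flow (as `x / 0 = 0`). -/
noncomputable def flowChoice [Fintype S] (M : ProbAutomaton S Act) (R : Setoid S)
    (A : Finset (PTransition S Act)) (t : S) (a : Act)
    (f : NetVertex R A → NetVertex R A → ℝ) (α : M.FinFrag) (tr : PTransition S Act) : ℝ :=
  if h : tr ∈ A ∧ tr.source = α.1.last then
    if α.1.trace M.hidden = [] ∧ tr.action ∈ M.hidden then
      f (.state α.1.last) (.trans ⟨tr, h.1⟩) / M.inflow R A t a f (.state α.1.last)
    else if α.1.trace M.hidden = [] ∧ a ∉ M.hidden ∧ tr.action = a then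
      f (.state α.1.last) (.transA ⟨tr, h.1⟩) / M.inflow R A t a f (.state α.1.last)
    else if α.1.trace M.hidden = [a] ∧ a ∉ M.hidden ∧ tr.action ∈ M.hidden then
      f (.stateA α.1.last) (.transA ⟨tr, h.1⟩) / M.inflow R A t a f (.stateA α.1.last)
    else 0
  else 0

/-- `σ` is the scheduler built from the flow `f`. -/
def Scheduler.IsBuiltFrom [Fintype S] {M : ProbAutomaton S Act} (σ : M.Scheduler)
    (R : Setoid S) (A : Finset (PTransition S Act)) (t : S) (a : Act)
    (f : NetVertex R A → NetVertex R A → ℝ) : Prop :=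
  ∀ (α : M.FinFrag) (tr : PTransition S Act),
    σ.prob α tr = ENNReal.ofReal (M.flowChoice R A t a f α tr)

end ProbAutomaton

/-! A feasible solution of the LP is a flow on two copies (layers) of the state space, before and
after the external action `a`; only the first is used when `a` is hidden. The rest of the network is
redundant: the balance equations determine the flow out of a transition vertex, and the class arcs
say that the outlet has the same class masses as `μ`, which is `LiftRel`
(`liftRel_iff_sum_eq_classProb`).

From flow to scheduler (`inducesAllowedWeak_of_flow`): choose transitions in proportion to the flow.
A flow may contain circulations that the execution never enters, so the expected number of visits to
a vertex need not equal the flow through it, but by induction on the number of steps it is at most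
that flow. Hence the expected numbers of visits are finite and the stopping probabilities are
bounded by the outlet. Since everything is finite, summing the balance equations shows that the
total stopping probability is 1, which is also the total outlet, so the bounds are equalities.

From scheduler to flow (`InducesAllowedWeak.exists_isLayerFlow`): expected numbers of choices, which
forget the history, should form the flow, but a scheduler that stops almost surely may make
infinitely many steps on average. Truncation after `n` steps gives finite flows with a leak, whose
outlets converge to the final distribution although the flows themselves may diverge. Finitely
generated cones are closed (`LinearMap.isClosed_image_nonneg`), so the limit outlet belongs to some
finite flow with a leak; the total balance then forces the leak to vanish.

An optimal solution exists once a feasible one does, since the objective bounds every arc on the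
part of the feasible set that is at least as good as the given solution. -/

open scoped ENNReal

/-! ### Closedness of finitely generated convex cones -/

open Classical in
/-- A linear map sends the nonnegative vectors supported in a given finite set onto a closed set. -/
theorem LinearMap.isClosed_image_nonneg_face {ι E : Type*} [Fintype ι] [NormedAddCommGroup E]
    [NormedSpace ℝ E] [FiniteDimensional ℝ E] (L : (ι → ℝ) →ₗ[ℝ] E) (s : Finset ι) :
    IsClosed (L '' {x | 0 ≤ x ∧ ∀ i, i ∉ s → x i = 0}) := by
  induction s using Finset.strongInduction with
  | _ s ih =>
    let W : Submodule ℝ (ι → ℝ) :=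
      { carrier := {x | ∀ i, i ∉ s → x i = 0}
        add_mem' := fun {x y} hx hy i hi => by simp [hx i hi, hy i hi]
        zero_mem' := fun i _ => rfl
        smul_mem' := fun c x hx i hi => by simp [hx i hi] }
    by_cases hinj : LinearMap.ker (L.domRestrict W) = ⊥
    · have hemb := LinearMap.isClosedEmbedding_of_injective hinj
      have hcl : IsClosed {x : W | (0 : ι → ℝ) ≤ x} :=
        isClosed_le continuous_const continuous_subtype_val
      convert hemb.isClosedMap _ hcl using 1
      ext y
      constructor
      · rintro ⟨x, ⟨hx, hs⟩, rfl⟩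
        exact ⟨⟨x, hs⟩, hx, rfl⟩
      · rintro ⟨x, hx, rfl⟩
        exact ⟨x, ⟨hx, x.2⟩, rfl⟩
    -- A nonzero kernel vector has a positive coordinate, possibly after a change of sign.
    · obtain ⟨z, hzs, hLz, i₀, hi₀⟩ : ∃ z : ι → ℝ, (∀ i, i ∉ s → z i = 0) ∧ L z = 0 ∧
          ∃ i, 0 < z i := by
        obtain ⟨z, hz, hz0⟩ := Submodule.exists_mem_ne_zero_of_ne_bot hinj
        have hLz : L z = 0 := hz
        have : ∃ i, (z : ι → ℝ) i ≠ 0 := by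
          by_contra! h
          exact hz0 (Subtype.ext (funext h))
        obtain ⟨i, hi⟩ := this
        rcases lt_or_gt_of_ne hi with h | h
        · exact ⟨-z, fun j hj => by simp [z.2 j hj], by simp [hLz], i, by simpa using h⟩
        · exact ⟨z, z.2, hLz, i, h⟩
      -- Carathéodory's reduction: moving along the kernel direction `z` until the first coordinate
      -- reaches zero keeps the image and shrinks the allowed support. The minimal ratio `x i / z i`
      -- is how far one can move without leaving the orthant.
      have hunion : L '' {x | 0 ≤ x ∧ ∀ i, i ∉ s → x i = 0} =
          ⋃ i ∈ s, L '' {x | 0 ≤ x ∧ ∀ j, j ∉ s.erase i → x j = 0} := by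
        apply Set.Subset.antisymm
        · rintro _ ⟨x, ⟨hx, hxs⟩, rfl⟩
          obtain ⟨i, hi, hmin⟩ := Finset.exists_min_image {i | 0 < z i} (fun i => x i / z i)
            ⟨i₀, by simpa using hi₀⟩
          simp only [Finset.mem_filter, Finset.mem_univ, true_and] at hi hmin
          have his : i ∈ s := by
            by_contra h
            exact hi.ne' (hzs i h)
          refine Set.mem_biUnion his ⟨x - (x i / z i) • z, ⟨fun j => ?_, fun j hj => ?_⟩, ?_⟩
          · have hl : 0 ≤ x i / z i := div_nonneg (hx i) hi.le
            have hxj : 0 ≤ x j := hx j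
            simp only [Pi.zero_apply, Pi.sub_apply, Pi.smul_apply, smul_eq_mul, sub_nonneg]
            rcases le_or_gt (z j) 0 with h | h
            · exact (mul_nonpos_of_nonneg_of_nonpos hl h).trans hxj
            · exact (le_div_iff₀ h).1 (hmin j h)
          · by_cases hji : j = i
            · subst hji
              simp [hi.ne']
            · have : j ∉ s := fun h => hj (Finset.mem_erase.2 ⟨hji, h⟩)
              simp [hxs j this, hzs j this]
          · simp [hLz]
        · refine Set.iUnion₂_subset fun i _ => Set.image_mono ?_
          rintro x ⟨hx, h⟩
          exact ⟨hx, fun j hj => h j fun h' => hj (Finset.mem_of_mem_erase h')⟩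
      rw [hunion]
      exact s.finite_toSet.isClosed_biUnion fun i hi => ih _ (Finset.erase_ssubset hi)

/-- Finitely generated convex cones are closed. -/
theorem LinearMap.isClosed_image_nonneg {ι E : Type*} [Fintype ι] [NormedAddCommGroup E]
    [NormedSpace ℝ E] [FiniteDimensional ℝ E] (L : (ι → ℝ) →ₗ[ℝ] E) :
    IsClosed (L '' {x | 0 ≤ x}) := by
  simpa using L.isClosed_image_nonneg_face Finset.univ

/-! ### Sums over alternating sequences -/

namespace AltSeq

variable {S Act : Type*}

/-- The number of steps. -/
def len : AltSeq S Act → ℕ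
  | .init _ => 0
  | .step α _ _ => α.len + 1

/-- A sequence is a single state or extends another one by a step. -/
def equivSum : AltSeq S Act ≃ S ⊕ (AltSeq S Act × Act × S) where
  toFun
    | .init s => .inl s
    | .step α b v => .inr (α, b, v)
  invFun
    | .inl s => .init s
    | .inr (α, b, v) => .step α b v
  left_inv := by rintro (s | ⟨α, b, v⟩) <;> rfl
  right_inv := by rintro (s | ⟨α, b, v⟩) <;> rfl

theorem tsum_eq (F : AltSeq S Act → ℝ≥0∞) :
    ∑' α, F α = ∑' s, F (.init s) + ∑' α, ∑' b, ∑' v, F (.step α b v) := by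
  rw [← equivSum.symm.tsum_eq F, ENNReal.summable.tsum_sum ENNReal.summable,
    ENNReal.tsum_prod']
  simp_rw [ENNReal.tsum_prod']
  rfl

theorem not_mem_of_mem_trace {H : Set Act} {α : AltSeq S Act} {b : Act} (h : b ∈ α.trace H) :
    b ∉ H := by
  induction α with
  | init s => simp [trace] at h
  | step α c v ih =>
    rw [trace] at h
    split_ifs at h with hc
    · exact ih h
    · rcases List.mem_append.1 h with h | h
      · exact ih h
      · rw [List.mem_singleton] at h
        exact h ▸ hc

open Classical in
/-- The sums over the sequences of length less than `n` converge to the sum over all sequences. -/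
theorem tendsto_tsum_len_lt (F : AltSeq S Act → ℝ≥0∞) :
    Filter.Tendsto (fun n : ℕ => ∑' α : AltSeq S Act, if α.len < n then F α else 0)
      Filter.atTop (nhds (∑' α, F α)) := by
  refine tendsto_order.2 ⟨fun c hc => ?_, fun c hc => .of_forall fun n => ?_⟩
  · rw [ENNReal.tsum_eq_iSup_sum, lt_iSup_iff] at hc
    obtain ⟨s, hs⟩ := hc
    filter_upwards [Filter.eventually_gt_atTop (s.sup len)] with n hn
    refine (hs.trans_le (Finset.sum_le_sum fun α hα => ?_)).trans_le (ENNReal.sum_le_tsum s)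
    rw [if_pos ((Finset.le_sup hα).trans_lt hn)]
  · refine (ENNReal.tsum_le_tsum fun α => ?_).trans_lt hc
    split_ifs <;> simp

end AltSeq

/-! ### Scheduler probabilities on all alternating sequences -/

namespace ProbAutomaton

variable {S Act : Type*} {M : ProbAutomaton S Act}

namespace Scheduler

open Classical in
/-- The choice of a scheduler, extended by `0` to all alternating sequences. -/
noncomputable def choice (σ : M.Scheduler) (α : AltSeq S Act) (tr : PTransition S Act) : ℝ≥0∞ :=
  if h : M.IsFrag α then σ.prob ⟨α, h⟩ tr else 0

open Classical in
/-- The cone probability, extended by `0` to all alternating sequences. -/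
noncomputable def weight (σ : M.Scheduler) (s : S) (α : AltSeq S Act) : ℝ≥0∞ :=
  if h : M.IsFrag α then σ.coneProb s α h else 0

/-- The probability of stopping after an alternating sequence. -/
noncomputable def halt (σ : M.Scheduler) (α : AltSeq S Act) : ℝ≥0∞ :=
  1 - ∑ tr ∈ M.trans, σ.choice α tr

theorem sum_choice_le_one (σ : M.Scheduler) (α : AltSeq S Act) :
    ∑ tr ∈ M.trans, σ.choice α tr ≤ 1 := by
  unfold choice
  split_ifs with h
  · exact σ.sum_le_one ⟨α, h⟩
  · simp

theorem sum_choice_add_halt (σ : M.Scheduler) (α : AltSeq S Act) :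
    ∑ tr ∈ M.trans, σ.choice α tr + σ.halt α = 1 :=
  add_tsub_cancel_of_le (σ.sum_choice_le_one α)

theorem source_eq_of_choice_ne_zero (σ : M.Scheduler) {α : AltSeq S Act}
    {tr : PTransition S Act} (h : σ.choice α tr ≠ 0) : tr ∈ M.trans ∧ tr.source = α.last := by
  unfold choice at h
  split_ifs at h with hα
  · exact σ.enabled _ _ h
  · exact absurd rfl h

open Classical in
theorem weight_init (σ : M.Scheduler) (s v : S) :
    σ.weight s (.init v) = if v = s then 1 else 0 := by
  simp [weight, IsFrag, coneProb]

-- The extension by zero respects the recursion: if `α` is a fragment but the longer sequence is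
-- not, no transition in the sum is both chosen and able to reach `v`.
open Classical in
theorem weight_step (σ : M.Scheduler) (s : S) (α : AltSeq S Act) (b : Act) (v : S) :
    σ.weight s (.step α b v) =
      σ.weight s α * ∑ tr ∈ M.trans with tr.action = b, σ.choice α tr * tr.target v := by
  by_cases hα : M.IsFrag α
  · by_cases h : M.IsFrag (.step α b v)
    · simp [weight, choice, h, hα, coneProb]
    · rw [weight, dif_neg h, Finset.sum_eq_zero, mul_zero]
      intro tr htr
      rw [Finset.mem_filter] at htr
      by_contra hne
      obtain ⟨h1, h2⟩ := mul_ne_zero_iff.1 hne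
      exact h ⟨hα, tr, htr.1, (σ.source_eq_of_choice_ne_zero h1).2, htr.2, pos_iff_ne_zero.2 h2⟩
  · have h : ¬ M.IsFrag (.step α b v) := fun h => hα h.1
    simp [weight, h, hα]

/-- Conditioning on the last step. This identity is the source of the flow equations for expected
visits and of the bound on truncated sums. -/
theorem tsum_weight_mul [Fintype S] (σ : M.Scheduler) (s : S) (φ : AltSeq S Act → ℝ≥0∞) :
    ∑' α, σ.weight s α * φ α = φ (.init s) + ∑' α, σ.weight s α *
      ∑ tr ∈ M.trans, σ.choice α tr * ∑ v, tr.target v * φ (.step α tr.action v) := by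
  classical
  rw [AltSeq.tsum_eq]
  congr 1
  · rw [tsum_eq_single s fun v hv => by simp [weight_init, hv]]
    simp [weight_init]
  · refine tsum_congr fun α => ?_
    simp_rw [weight_step, tsum_fintype, mul_assoc, ← Finset.mul_sum, ENNReal.tsum_mul_left]
    congr 1
    simp_rw [Finset.sum_mul, Finset.sum_filter]
    simp_rw [Finset.sum_comm (s := Finset.univ) (t := M.trans)]
    rw [Summable.tsum_finsetSum fun _ _ => ENNReal.summable]
    refine Finset.sum_congr rfl fun tr _ => ?_
    rw [tsum_eq_single tr.action fun b hb => by simp [hb.symm]]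
    simp [Finset.mul_sum, mul_assoc]

open Classical in
theorem setProb_eq (σ : M.Scheduler) (s : S) (P : AltSeq S Act → Prop) :
    σ.setProb s {α | P α.1} = ∑' α, σ.weight s α * (if P α then σ.halt α else 0) := by
  rw [setProb, tsum_subtype {α : M.FinFrag | P α.1} (σ.fragProb s)]
  rw [← tsum_subtype_eq_of_support_subset (s := {α | M.IsFrag α})]
  · refine tsum_congr fun α => ?_
    have h : M.IsFrag α.1 := α.2
    by_cases hP : P α.1
    · simp [Set.indicator, hP, fragProb, weight, h, halt, choice, stopProb]
    · simp [Set.indicator, hP]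
  · intro α hα
    by_contra h
    have h : ¬ M.IsFrag α := h
    simp [weight, h] at hα

end Scheduler

end ProbAutomaton

/-! ### The two layers -/

/-- The traces that a weak transition labeled by an external action `a` goes through: before `a`
(`false`) and after it (`true`). -/
def layerTrace {Act : Type*} (a : Act) : Bool → List Act
  | false => []
  | true => [a]

/-- The action `b` can be performed in layer `i`. -/
def LayerOk {Act : Type*} (H : Set Act) (a : Act) (i : Bool) (b : Act) : Prop :=
  (b ∈ H ∧ (i = false ∨ a ∉ H)) ∨ (i = false ∧ a ∉ H ∧ b = a)

open Classical in
/-- The layer reached from layer `i` by the action `b`. -/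
noncomputable def nextLayer {Act : Type*} (H : Set Act) (i : Bool) (b : Act) : Bool :=
  if b ∈ H then i else true

open Classical in
/-- The layer in which a weak transition labeled by `a` stops. -/
noncomputable def lastLayer {Act : Type*} (H : Set Act) (a : Act) : Bool :=
  if a ∈ H then false else true

theorem layerTrace_injective {Act : Type*} (a : Act) : Function.Injective (layerTrace a) := by
  intro i j h
  cases i <;> cases j <;> simp_all [layerTrace]

theorem layerTrace_lastLayer {Act : Type*} (H : Set Act) (a : Act) :
    layerTrace a (lastLayer H a) = actionTrace H a := by
  unfold lastLayer actionTrace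
  split_ifs <;> rfl

namespace AltSeq

variable {S Act : Type*}

theorem trace_step_eq_of_layerOk {H : Set Act} {a : Act} {j : Bool} {b : Act}
    {α : AltSeq S Act} (v : S) (hj : α.trace H = layerTrace a j) (h : LayerOk H a j b) :
    (step α b v).trace H = layerTrace a (nextLayer H j b) := by
  rcases h with ⟨hb, -⟩ | ⟨rfl, ha, rfl⟩
  · simp [trace, nextLayer, hb, hj]
  · simp [trace, nextLayer, ha, hj, layerTrace]

/-- A hidden step keeps the layer, and an external one can only be the action `a` itself, appended
to the empty trace. In the second layer the side condition `a ∉ H` is automatic, because traces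
contain external actions only. -/
theorem exists_layer_of_trace_step_eq {H : Set Act} {a : Act} {i : Bool} {b : Act}
    {α : AltSeq S Act} {v : S} (h : (step α b v).trace H = layerTrace a i) :
    ∃ j, α.trace H = layerTrace a j ∧ LayerOk H a j b ∧ nextLayer H j b = i := by
  by_cases hb : b ∈ H
  · have h' : α.trace H = layerTrace a i := by simpa [trace, hb] using h
    refine ⟨i, h', .inl ⟨hb, ?_⟩, by simp [nextLayer, hb]⟩
    cases i
    · exact .inl rfl
    · exact .inr (not_mem_of_mem_trace (α := α) (by simp [h', layerTrace]))
  · have h' : α.trace H ++ [b] = layerTrace a i := by simpa [trace, hb] using h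
    cases i
    · simp [layerTrace] at h'
    · have h2 : α.trace H ++ [b] = [] ++ [a] := h'
      obtain ⟨h3, h4⟩ := List.append_inj' h2 rfl
      obtain rfl : b = a := by simpa using h4
      exact ⟨false, h3, .inr ⟨rfl, hb, rfl⟩, by simp [nextLayer, hb]⟩

-- At most one `j` contributes, as `layerTrace` is injective. Writing the indicator as a sum over
-- previous layers makes the equation for the visits linear in the choices of each layer.
open Classical in
theorem ite_trace_step {R : Type*} [AddCommMonoid R] (H : Set Act) (a : Act) (i : Bool) (b : Act)
    (α : AltSeq S Act) (v : S) (r : R) :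
    (if (step α b v).trace H = layerTrace a i then r else 0) =
      ∑ j, if nextLayer H j b = i then
        (if LayerOk H a j b then if α.trace H = layerTrace a j then r else 0 else 0) else 0 := by
  split_ifs with h
  · obtain ⟨j, h1, h2, h3⟩ := exists_layer_of_trace_step_eq h
    rw [Finset.sum_eq_single j]
    · simp [h1, h2, h3]
    · intro k _ hk
      have : ¬ layerTrace a j = layerTrace a k := fun h => hk (layerTrace_injective a h).symm
      simp [h1, this]
    · simp
  · symm
    refine Finset.sum_eq_zero fun j _ => ?_
    split_ifs with h1 h2 h3
    · exact absurd (h1 ▸ trace_step_eq_of_layerOk v h3 h2) h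
    all_goals rfl

end AltSeq

/-! ### Expected visits, choices and stops -/

namespace ProbAutomaton.Scheduler

variable {S Act : Type*} {M : ProbAutomaton S Act}

open Classical in
/-- The expected number of visits to the state `v` in layer `i` during the first `n` steps. -/
noncomputable def visits (σ : M.Scheduler) (t : S) (a : Act) (n : ℕ∞) (i : Bool) (v : S) : ℝ≥0∞ :=
  ∑' α : AltSeq S Act, σ.weight t α *
    if α.len < n ∧ α.last = v then if α.trace M.hidden = layerTrace a i then 1 else 0 else 0

open Classical in
/-- The expected number of choices of the transition `tr` in layer `i` during the first `n` steps.
-/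
noncomputable def choices (σ : M.Scheduler) (t : S) (a : Act) (n : ℕ∞) (i : Bool)
    (tr : PTransition S Act) : ℝ≥0∞ :=
  ∑' α : AltSeq S Act, σ.weight t α *
    if α.len < n then if α.trace M.hidden = layerTrace a i then σ.choice α tr else 0 else 0

open Classical in
/-- The expected number of those choices of a transition that lead to one of the two layers. -/
noncomputable def okChoices (σ : M.Scheduler) (t : S) (a : Act) (n : ℕ∞) (i : Bool)
    (tr : PTransition S Act) : ℝ≥0∞ :=
  if LayerOk M.hidden a i tr.action then σ.choices t a n i tr else 0

open Classical in
/-- The probability of stopping in the state `v` of layer `i` during the first `n` steps. -/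
noncomputable def halts (σ : M.Scheduler) (t : S) (a : Act) (n : ℕ∞) (i : Bool) (v : S) : ℝ≥0∞ :=
  ∑' α : AltSeq S Act, σ.weight t α *
    if α.len < n ∧ α.last = v then
      if α.trace M.hidden = layerTrace a i then σ.halt α else 0 else 0

theorem sum_choice_eq (σ : M.Scheduler) {A : Finset (PTransition S Act)} (hA : A ⊆ M.trans)
    (hσ : ∀ α tr, σ.choice α tr ≠ 0 → tr ∈ A) (α : AltSeq S Act) (F : PTransition S Act → ℝ≥0∞) :
    ∑ tr ∈ M.trans, σ.choice α tr * F tr = ∑ tr ∈ A, σ.choice α tr * F tr := by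
  symm
  refine Finset.sum_subset hA fun tr _ h => ?_
  rw [not_ne_iff.1 (mt (hσ α tr) h), zero_mul]

-- `tsum_weight_mul` applied to the indicator of the layer, the state and the length. Bounds in `ℕ∞`
-- cover both the truncated recursion and, since `⊤ + 1 = ⊤`, the equation for the full
-- expectations.
open Classical in
theorem visits_succ [Fintype S] (σ : M.Scheduler) {A : Finset (PTransition S Act)}
    (hA : A ⊆ M.trans) (hσ : ∀ α tr, σ.choice α tr ≠ 0 → tr ∈ A) (t : S) (a : Act) (n : ℕ∞)
    (i : Bool) (v : S) :
    σ.visits t a (n + 1) i v = (if i = false ∧ v = t then 1 else 0) +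
      ∑ tr ∈ A, ∑ j, if nextLayer M.hidden j tr.action = i then
        σ.okChoices t a n j tr * tr.target v else 0 := by
  rw [visits, tsum_weight_mul]
  congr 1
  · have : (0 : ℕ∞) < n + 1 := by simp
    cases i <;> simp [AltSeq.len, AltSeq.last, AltSeq.trace, layerTrace, this, eq_comm]
  · have key : ∀ α : AltSeq S Act, σ.weight t α * ∑ tr ∈ M.trans, σ.choice α tr *
        ∑ u, tr.target u * (if (AltSeq.step α tr.action u).len < n + 1 ∧
          (AltSeq.step α tr.action u).last = v then
          if (AltSeq.step α tr.action u).trace M.hidden = layerTrace a i then 1 else 0 else 0) =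
        ∑ tr ∈ A, ∑ j, if nextLayer M.hidden j tr.action = i then
          (if LayerOk M.hidden a j tr.action then (σ.weight t α *
            if α.len < n then if α.trace M.hidden = layerTrace a j then σ.choice α tr else 0
              else 0) else 0) * tr.target v else 0 := by
      intro α
      rw [σ.sum_choice_eq hA hσ, Finset.mul_sum]
      refine Finset.sum_congr rfl fun tr _ => ?_
      have hlen : (((AltSeq.step α tr.action v).len : ℕ) : ℕ∞) < n + 1 ↔ (α.len : ℕ∞) < n := by
        simp only [AltSeq.len, Nat.cast_add, Nat.cast_one]
        exact ENat.add_lt_add_iff_right (by simp)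
      rw [Finset.sum_eq_single v (fun u _ hu => by simp [AltSeq.last, hu]) (by simp)]
      simp only [hlen, AltSeq.ite_trace_step]
      by_cases hn : (α.len : ℕ∞) < n
      · simp only [hn, AltSeq.last, and_self, if_true, Finset.mul_sum]
        refine Finset.sum_congr rfl fun j _ => ?_
        split_ifs <;> simp [mul_assoc]
      · simp [hn]
    simp_rw [key]
    rw [Summable.tsum_finsetSum fun _ _ => ENNReal.summable]
    refine Finset.sum_congr rfl fun tr _ => ?_
    rw [Summable.tsum_finsetSum fun _ _ => ENNReal.summable]
    refine Finset.sum_congr rfl fun j _ => ?_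
    unfold okChoices choices
    split_ifs
    · rw [ENNReal.tsum_mul_right]
    · simp
    · simp

-- Holds sequence by sequence: after each visit the scheduler either chooses a transition or stops.
open Classical in
theorem sum_choices_add_halts (σ : M.Scheduler) {A : Finset (PTransition S Act)}
    (hA : A ⊆ M.trans) (hσ : ∀ α tr, σ.choice α tr ≠ 0 → tr ∈ A) (t : S) (a : Act) (n : ℕ∞)
    (i : Bool) (v : S) :
    ∑ tr ∈ A with tr.source = v, σ.choices t a n i tr + σ.halts t a n i v =
      σ.visits t a n i v := by
  unfold choices halts visits
  rw [← Summable.tsum_finsetSum fun _ _ => ENNReal.summable, ← ENNReal.tsum_add]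
  refine tsum_congr fun α => ?_
  rw [← Finset.mul_sum, ← mul_add]
  congr 1
  by_cases hn : (α.len : ℕ∞) < n
  · by_cases hi : α.trace M.hidden = layerTrace a i
    · by_cases hv : α.last = v
      · simp only [hn, hi, hv, and_self, if_true]
        rw [← σ.sum_choice_add_halt α]
        congr 1
        have := σ.sum_choice_eq hA hσ α 1
        simp only [Pi.one_apply, mul_one] at this
        rw [this, Finset.sum_filter]
        refine Finset.sum_congr rfl fun tr _ => ?_
        split_ifs with h
        · rfl
        · by_contra h0
          exact h ((σ.source_eq_of_choice_ne_zero (Ne.symm h0)).2.trans hv)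
      · simp only [hn, hi, hv, and_false, if_true, if_false, add_zero]
        refine Finset.sum_eq_zero fun tr htr => ?_
        by_contra h0
        exact hv ((σ.source_eq_of_choice_ne_zero h0).2.symm.trans (Finset.mem_filter.1 htr).2)
    · simp [hi]
  · simp [hn]

theorem okChoices_le_choices (σ : M.Scheduler) (t : S) (a : Act) (n : ℕ∞) (i : Bool)
    (tr : PTransition S Act) : σ.okChoices t a n i tr ≤ σ.choices t a n i tr := by
  unfold okChoices
  split_ifs <;> simp

theorem visits_mono (σ : M.Scheduler) (t : S) (a : Act) {m n : ℕ∞} (h : m ≤ n) (i : Bool)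
    (v : S) : σ.visits t a m i v ≤ σ.visits t a n i v := by
  classical
  refine ENNReal.tsum_le_tsum fun α => mul_le_mul_right ?_ _
  by_cases hm : (α.len : ℕ∞) < m
  · simp [hm, hm.trans_le h]
  · simp [hm]

open Classical in
theorem tendsto_tsum_weight_mul (σ : M.Scheduler) (t : S) (P : AltSeq S Act → Prop)
    (F : AltSeq S Act → ℝ≥0∞) :
    Filter.Tendsto (fun n : ℕ => ∑' α : AltSeq S Act, σ.weight t α *
      if (α.len : ℕ∞) < (n : ℕ∞) ∧ P α then F α else 0) Filter.atTop
      (nhds (∑' α : AltSeq S Act, σ.weight t α *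
        if (α.len : ℕ∞) < ⊤ ∧ P α then F α else 0)) := by
  have h := AltSeq.tendsto_tsum_len_lt fun α => σ.weight t α * if P α then F α else 0
  simpa [ite_and] using h

theorem tendsto_visits (σ : M.Scheduler) (t : S) (a : Act) (i : Bool) (v : S) :
    Filter.Tendsto (fun n : ℕ => σ.visits t a n i v) Filter.atTop
      (nhds (σ.visits t a ⊤ i v)) :=
  σ.tendsto_tsum_weight_mul t _ _

theorem tendsto_halts (σ : M.Scheduler) (t : S) (a : Act) (i : Bool) (v : S) :
    Filter.Tendsto (fun n : ℕ => σ.halts t a n i v) Filter.atTop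
      (nhds (σ.halts t a ⊤ i v)) :=
  σ.tendsto_tsum_weight_mul t _ _

end ProbAutomaton.Scheduler

/-! ### Summation lemmas -/

theorem PMF.sum_coe {S : Type*} [Fintype S] (p : PMF S) : ∑ v, p v = 1 :=
  (tsum_fintype p).symm.trans p.tsum_coe

/-- The total amount that enters the states: one unit at the start, and what is sent to the
transitions. -/
theorem sum_sum_ite_next {R S ι : Type*} [CommSemiring R] [Fintype S] [DecidableEq S]
    (A : Finset ι) (t : S) (next : Bool → ι → Bool) (p : ι → S → R)
    (hp : ∀ τ ∈ A, ∑ v, p τ v = 1) (G : Bool → ι → R) :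
    ∑ i : Bool, ∑ v : S, ((if i = false ∧ v = t then 1 else 0) +
      ∑ τ ∈ A, ∑ j, if next j τ = i then G j τ * p τ v else 0) =
      1 + ∑ τ ∈ A, ∑ j, G j τ := by
  simp_rw [Finset.sum_add_distrib]
  congr 1
  · simp [Finset.filter_eq']
  · simp_rw [Finset.sum_comm (s := Finset.univ) (t := A)]
    refine Finset.sum_congr rfl fun τ hτ => ?_
    rw [Finset.sum_congr rfl fun i _ => Finset.sum_comm, Finset.sum_comm]
    refine Finset.sum_congr rfl fun j _ => ?_
    rw [Finset.sum_comm]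
    simp [← Finset.mul_sum, hp τ hτ]

/-- Finiteness of the sums allows the comparison to be made in `ℝ`; with infinite sums the claim
fails. -/
theorem Finset.eq_of_le_of_sum_eq_ennreal {ι : Type*} {s : Finset ι} {f g : ι → ℝ≥0∞}
    (hle : ∀ i ∈ s, f i ≤ g i) (hsum : ∑ i ∈ s, f i = ∑ i ∈ s, g i) (hg : ∑ i ∈ s, g i ≠ ⊤) :
    ∀ i ∈ s, f i = g i := by
  have hg' := ENNReal.sum_ne_top.1 hg
  have hf' : ∀ i ∈ s, f i ≠ ⊤ := fun i hi => ne_top_of_le_ne_top (hg' i hi) (hle i hi)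
  have h := congrArg ENNReal.toReal hsum
  rw [ENNReal.toReal_sum hf', ENNReal.toReal_sum hg'] at h
  have := (Finset.sum_eq_sum_iff_of_le fun i hi => ENNReal.toReal_mono (hg' i hi) (hle i hi)).1 h
  exact fun i hi => (ENNReal.toReal_eq_toReal_iff' (hf' i hi) (hg' i hi)).1 (this i hi)

/-! ### From flows to schedulers -/

namespace ProbAutomaton.Scheduler

variable {S Act : Type*} {M : ProbAutomaton S Act}

/-- No induction is needed: the choice behind the last step already places the preceding sequence in
a layer. -/
theorem exists_layer_of_weight_ne_zero (σ : M.Scheduler) (t : S) (a : Act)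
    (hσ : ∀ α tr, σ.choice α tr ≠ 0 →
      ∃ i, α.trace M.hidden = layerTrace a i ∧ LayerOk M.hidden a i tr.action)
    (α : AltSeq S Act) (h : σ.weight t α ≠ 0) : ∃ i, α.trace M.hidden = layerTrace a i := by
  classical
  cases α with
  | init s => exact ⟨false, rfl⟩
  | step α b v =>
    rw [weight_step] at h
    obtain ⟨tr, htr, hne⟩ := Finset.exists_ne_zero_of_sum_ne_zero (mul_ne_zero_iff.1 h).2
    obtain ⟨i, h1, h2⟩ := hσ α tr (mul_ne_zero_iff.1 hne).1
    rw [(Finset.mem_filter.1 htr).2] at h2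
    exact ⟨_, AltSeq.trace_step_eq_of_layerOk v h1 h2⟩

theorem isFrag_of_weight_ne_zero (σ : M.Scheduler) {t : S} {α : AltSeq S Act}
    (h : σ.weight t α ≠ 0) : M.IsFrag α := by
  by_contra hα
  simp [weight, hα] at h

open Classical in
/-- A scheduler that follows a finite flow stops with the probabilities given by the flow. -/
theorem inducesAllowedWeak_of_flow [Fintype S] (σ : M.Scheduler)
    {A : Finset (PTransition S Act)} (hA : A ⊆ M.trans) (t : S) (a : Act)
    (g : Bool → PTransition S Act → ℝ≥0∞) (F : Bool → S → ℝ≥0∞) (ν : PMF S)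
    (hF : ∀ i v, F i v ≠ ⊤)
    (hin : ∀ i v, F i v = (if i = false ∧ v = t then 1 else 0) +
      ∑ tr ∈ A, ∑ j, if nextLayer M.hidden j tr.action = i then g j tr * tr.target v else 0)
    (hout : ∀ i v, F i v = ∑ tr ∈ A with tr.source = v, g i tr +
      if i = lastLayer M.hidden a then ν v else 0)
    (hσA : ∀ α tr, σ.choice α tr ≠ 0 → tr ∈ A)
    (hσF : ∀ α tr i, M.IsFrag α → α.trace M.hidden = layerTrace a i → tr ∈ A →
      tr.source = α.last → σ.choice α tr * F i α.last = g i tr)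
    (hσ : ∀ α tr, σ.choice α tr ≠ 0 →
      ∃ i, α.trace M.hidden = layerTrace a i ∧ LayerOk M.hidden a i tr.action) :
    σ.InducesAllowedWeak A t a ν := by
  have hok : ∀ n i tr, σ.okChoices t a n i tr = σ.choices t a n i tr := by
    intro n i tr
    unfold okChoices choices
    split_ifs with h
    · rfl
    · symm
      refine ENNReal.tsum_eq_zero.2 fun α => mul_eq_zero_of_right _ ?_
      split_ifs with h1 h2
      · by_contra h0
        obtain ⟨j, h3, h4⟩ := hσ α tr h0
        exact h (layerTrace_injective a (h2.symm.trans h3) ▸ h4)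
      all_goals rfl
  -- The conditional probability of `tr` is `g i tr / F i tr.source`; the product form avoids
  -- division where the flow vanishes.
  have hchoices : ∀ n i, ∀ tr ∈ A,
      σ.choices t a n i tr * F i tr.source = σ.visits t a n i tr.source * g i tr := by
    intro n i tr htr
    unfold choices visits
    rw [← ENNReal.tsum_mul_right, ← ENNReal.tsum_mul_right]
    refine tsum_congr fun α => ?_
    by_cases hw : σ.weight t α = 0
    · simp [hw]
    simp only [mul_assoc]
    congr 1
    by_cases hi : α.trace M.hidden = layerTrace a i
    · by_cases hv : α.last = tr.source
      · have := hσF α tr i (σ.isFrag_of_weight_ne_zero hw) hi htr hv.symm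
        rw [hv] at this
        by_cases hn : (α.len : ℕ∞) < n
        · simp [hi, hv, hn, this]
        · simp [hn]
      · have : σ.choice α tr = 0 := by
          by_contra h0
          exact hv (σ.source_eq_of_choice_ne_zero h0).2.symm
        simp [hv, this]
    · simp [hi]
  have hhalts : ∀ n i v, σ.halts t a n i v * F i v =
      σ.visits t a n i v * if i = lastLayer M.hidden a then ν v else 0 := by
    intro n i v
    unfold halts visits
    rw [← ENNReal.tsum_mul_right, ← ENNReal.tsum_mul_right]
    refine tsum_congr fun α => ?_
    by_cases hw : σ.weight t α = 0
    · simp [hw]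
    simp only [mul_assoc]
    congr 1
    by_cases hn : (α.len : ℕ∞) < n ∧ α.last = v
    swap
    · simp [hn]
    by_cases hi : α.trace M.hidden = layerTrace a i
    swap
    · simp [hi]
    obtain ⟨hn, rfl⟩ := hn
    simp only [hn, hi, and_self, if_true, one_mul]
    have h1 := σ.sum_choice_eq hA hσA α fun _ => F i α.last
    rw [← Finset.sum_mul] at h1
    have h2 : ∑ tr ∈ A, σ.choice α tr * F i α.last =
        ∑ tr ∈ A with tr.source = α.last, g i tr := by
      rw [Finset.sum_filter]
      refine Finset.sum_congr rfl fun tr htr => ?_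
      split_ifs with hs
      · exact hσF α tr i (σ.isFrag_of_weight_ne_zero hw) hi htr hs
      · have : σ.choice α tr = 0 := by
          by_contra h0
          exact hs (σ.source_eq_of_choice_ne_zero h0).2
        rw [this, zero_mul]
    have h3 : (∑ tr ∈ M.trans, σ.choice α tr + σ.halt α) * F i α.last = F i α.last := by
      rw [sum_choice_add_halt, one_mul]
    rw [add_mul, h1, h2] at h3
    have hfin : ∑ tr ∈ A with tr.source = α.last, g i tr ≠ ⊤ :=
      ne_top_of_le_ne_top (hF i α.last) (by rw [hout]; exact le_self_add)
    exact (ENNReal.add_right_inj hfin).1 (h3.trans (hout i α.last))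
  have hle_choices : ∀ n i, ∀ tr ∈ A, (∀ v, σ.visits t a n i v ≤ F i v) →
      σ.choices t a n i tr ≤ g i tr := by
    intro n i tr htr h
    by_cases h0 : F i tr.source = 0
    · have h1 := h tr.source
      rw [h0, ← σ.sum_choices_add_halts hA hσA] at h1
      have h2 := (add_eq_zero.1 (le_zero_iff.1 h1)).1
      rw [Finset.sum_eq_zero_iff.1 h2 tr (by simp [htr])]
      exact zero_le
    · rw [← ENNReal.mul_le_mul_iff_left h0 (hF i tr.source), hchoices n i tr htr, mul_comm]
      exact mul_le_mul_right (h _) _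
  -- Only an inequality is available: `F` may include circulation that the execution never reaches.
  have hle : ∀ n : ℕ, ∀ i v, σ.visits t a n i v ≤ F i v := by
    intro n
    induction n with
    | zero => intro i v; simp [visits]
    | succ n ih =>
      intro i v
      rw [Nat.cast_succ, σ.visits_succ hA hσA, hin]
      refine add_le_add_right (Finset.sum_le_sum fun tr htr => Finset.sum_le_sum fun j _ => ?_) _
      split_ifs
      · rw [hok]
        exact mul_le_mul_left (hle_choices n j tr htr (ih j)) _
      · rfl
  have hle_top : ∀ i v, σ.visits t a ⊤ i v ≤ F i v := fun i v =>
    le_of_tendsto' (σ.tendsto_visits t a i v) fun n => hle n i v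
  have hhalts_le : ∀ i v, σ.halts t a ⊤ i v ≤ if i = lastLayer M.hidden a then ν v else 0 := by
    intro i v
    by_cases h0 : F i v = 0
    · have h1 := hle_top i v
      rw [h0, ← σ.sum_choices_add_halts hA hσA] at h1
      rw [(add_eq_zero.1 (le_zero_iff.1 h1)).2]
      exact zero_le
    · rw [← ENNReal.mul_le_mul_iff_left h0 (hF i v), hhalts, mul_comm]
      exact mul_le_mul_right (hle_top i v) _
  have hvisits_in : ∑ i, ∑ v, σ.visits t a ⊤ i v =
      1 + ∑ tr ∈ A, ∑ j, σ.choices t a ⊤ j tr := by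
    rw [← sum_sum_ite_next A t (fun j tr => nextLayer M.hidden j tr.action)
      (fun tr v => tr.target v) fun tr _ => tr.target.sum_coe]
    refine Finset.sum_congr rfl fun i _ => Finset.sum_congr rfl fun v _ => ?_
    have := σ.visits_succ hA hσA t a ⊤ i v
    rw [top_add] at this
    simpa only [hok] using this
  have hvisits_out : ∑ i, ∑ v, σ.visits t a ⊤ i v =
      ∑ tr ∈ A, ∑ j, σ.choices t a ⊤ j tr + ∑ i, ∑ v, σ.halts t a ⊤ i v := by
    simp_rw [← σ.sum_choices_add_halts hA hσA, Finset.sum_add_distrib]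
    congr 1
    rw [Finset.sum_comm (s := A)]
    refine Finset.sum_congr rfl fun i _ => ?_
    simp_rw [Finset.sum_filter]
    rw [Finset.sum_comm]
    simp
  -- This is where finiteness of the flow enters. It permits cancelling the choices from the two
  -- expressions for the total number of visits, so no mass escapes into infinite executions.
  have hfin : ∑ tr ∈ A, ∑ j, σ.choices t a ⊤ j tr ≠ ⊤ := by
    refine ne_top_of_le_ne_top (b := ∑ i, ∑ v, F i v) ?_ ?_
    · exact ENNReal.sum_ne_top.2 fun i _ => ENNReal.sum_ne_top.2 fun v _ => hF i v
    · refine le_trans ?_ (Finset.sum_le_sum fun i _ => Finset.sum_le_sum fun v _ => hle_top i v)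
      rw [hvisits_out]
      exact le_self_add
  have htotal : ∑ i, ∑ v, σ.halts t a ⊤ i v = 1 := by
    rw [hvisits_out, add_comm] at hvisits_in
    exact (ENNReal.add_left_inj hfin).1 hvisits_in
  have houtlet : ∑ i, ∑ v, (if i = lastLayer M.hidden a then ν v else 0) = 1 := by
    rw [Finset.sum_comm]
    simp [PMF.sum_coe]
  -- Termwise bounds between two families of total mass 1 are equalities.
  have heq : ∀ i v, σ.halts t a ⊤ i v = if i = lastLayer M.hidden a then ν v else 0 := by
    intro i v
    rw [← Finset.sum_product'] at htotal houtlet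
    exact Finset.eq_of_le_of_sum_eq_ennreal (s := Finset.univ ×ˢ Finset.univ)
      (f := fun x : Bool × S => σ.halts t a ⊤ x.1 x.2)
      (g := fun x : Bool × S => if x.1 = lastLayer M.hidden a then ν x.2 else 0)
      (fun x _ => hhalts_le x.1 x.2) (htotal.trans houtlet.symm) (by rw [houtlet]; simp) (i, v)
      (by simp)
  have hlast : ∀ v, ∑' α, σ.weight t α * (if α.last = v then σ.halt α else 0) = ν v := by
    intro v
    have h1 : ∑ i, σ.halts t a ⊤ i v = ν v := by simp [heq]
    rw [← h1]
    unfold halts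
    rw [← Summable.tsum_finsetSum fun _ _ => ENNReal.summable]
    refine tsum_congr fun α => ?_
    by_cases hw : σ.weight t α = 0
    · simp [hw]
    obtain ⟨i, hi⟩ := σ.exists_layer_of_weight_ne_zero t a hσ α hw
    rw [← Finset.mul_sum, Finset.sum_eq_single i]
    · simp [hi]
    · intro j _ hj
      have : ¬ layerTrace a i = layerTrace a j := fun h => hj (layerTrace_injective a h).symm
      simp [hi, this]
    · simp
  refine ⟨⟨?_, ?_, ?_⟩, ?_⟩
  · have h := σ.setProb_eq t fun _ => True
    have hu : {α : M.FinFrag | True} = Set.univ := rfl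
    rw [hu] at h
    rw [h, ← PMF.sum_coe ν]
    simp_rw [← hlast]
    rw [← Summable.tsum_finsetSum fun _ _ => ENNReal.summable]
    refine tsum_congr fun α => ?_
    rw [← Finset.mul_sum]
    simp
  · intro α hα
    have hα' : 0 < σ.weight t α.1 * σ.halt α.1 := by
      simpa [fragProb, weight, α.2, halt, choice, stopProb] using hα
    have hw : σ.weight t α.1 ≠ 0 := left_ne_zero_of_mul hα'.ne'
    obtain ⟨i, hi⟩ := σ.exists_layer_of_weight_ne_zero t a hσ α.1 hw
    have h1 : σ.weight t α.1 * σ.halt α.1 ≤ σ.halts t a ⊤ i α.1.last := by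
      refine le_trans (le_of_eq ?_) (ENNReal.le_tsum α.1)
      simp [hi]
    have h2 := hα'.trans_le h1
    rw [heq] at h2
    have h3 : i = lastLayer M.hidden a := by
      by_contra h
      simp [h] at h2
    rw [hi, h3, layerTrace_lastLayer]
  · intro v
    rw [σ.setProb_eq t fun α => α.last = v, hlast]
  · intro α tr h
    refine hσA α.1 tr ?_
    have h' : M.IsFrag α.1 := α.2
    simpa [choice, h'] using h.ne'

end ProbAutomaton.Scheduler

/-! ### Two-layer flows and limits of their outlets -/

open Classical in
/-- A flow in the two-layer network: `g i tr` is the amount sent to the transition `tr` from its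
source in layer `i`, and `outlet v` is the amount that leaves the network at the state `v` of the
last layer. -/
structure IsLayerFlow {S Act : Type*} (M : ProbAutomaton S Act)
    (A : Finset (PTransition S Act)) (t : S) (a : Act) (g : Bool → A → ℝ) (outlet : S → ℝ) :
    Prop where
  nonneg : ∀ i tr, 0 ≤ g i tr
  outlet_nonneg : ∀ v, 0 ≤ outlet v
  ok : ∀ i tr, g i tr ≠ 0 → LayerOk M.hidden a i tr.1.action
  conservation : ∀ i v, (if i = false ∧ v = t then 1 else 0) +
      ∑ tr : A, ∑ j, (if nextLayer M.hidden j tr.1.action = i then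
        g j tr * (tr.1.target v).toReal else 0) =
    ∑ tr : A, (if tr.1.source = v then g i tr else 0) +
      if i = lastLayer M.hidden a then outlet v else 0

theorem PMF.sum_toReal {S : Type*} [Fintype S] (p : PMF S) : ∑ v, (p v).toReal = 1 := by
  rw [← ENNReal.toReal_sum fun v _ => p.apply_ne_top v, p.sum_coe, ENNReal.toReal_one]

open Classical in
/-- The states that are reached by flows form a closed set: if some flows with a leak have outlet
parts that converge to a probability distribution, then there is a flow without a leak that has
this distribution as its outlet part. -/
theorem exists_isLayerFlow_of_tendsto {S Act : Type*} [Fintype S] {M : ProbAutomaton S Act}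
    {A : Finset (PTransition S Act)} {t : S} {a : Act} (g : ℕ → Bool → A → ℝ)
    (outlet : ℕ → S → ℝ) (ν : PMF S) (hg : ∀ n i tr, 0 ≤ g n i tr) (houtlet : ∀ n v, 0 ≤ outlet n v)
    (hok : ∀ n i tr, g n i tr ≠ 0 → LayerOk M.hidden a i tr.1.action)
    (hle : ∀ n i v, ∑ tr : A, (if tr.1.source = v then g n i tr else 0) +
        (if i = lastLayer M.hidden a then outlet n v else 0) ≤
      (if i = false ∧ v = t then 1 else 0) +
        ∑ tr : A, ∑ j, if nextLayer M.hidden j tr.1.action = i then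
          g n j tr * (tr.1.target v).toReal else 0)
    (hlim : ∀ v, Filter.Tendsto (fun n => outlet n v) Filter.atTop (nhds (ν v).toReal)) :
    ∃ g', IsLayerFlow M A t a g' fun v => (ν v).toReal := by
  let P : ((Bool × A) ⊕ (Bool × S) ⊕ S) → ((Bool × A) ⊕ (Bool × S) ⊕ S → ℝ) →ₗ[ℝ] ℝ :=
    LinearMap.proj
  let ok : Bool → A → ℝ := fun i tr => if LayerOk M.hidden a i tr.1.action then 1 else 0
  let L : ((Bool × A) ⊕ (Bool × S) ⊕ S → ℝ) →ₗ[ℝ] (Bool × S → ℝ) × (S → ℝ) :=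
    LinearMap.prod
      (LinearMap.pi fun p =>
        ∑ tr : A, (if tr.1.source = p.2 then ok p.1 tr else 0) • P (.inl (p.1, tr)) +
        (if p.1 = lastLayer M.hidden a then (1 : ℝ) else 0) • P (.inr (.inr p.2)) +
        P (.inr (.inl p)) -
        ∑ tr : A, ∑ j, (if nextLayer M.hidden j tr.1.action = p.1 then
          ok j tr * (tr.1.target p.2).toReal else 0) • P (.inl (j, tr)))
      (LinearMap.pi fun v => P (.inr (.inr v)))
  have hL1 : ∀ x i v, (L x).1 (i, v) =
      ∑ tr : A, (if tr.1.source = v then ok i tr * x (.inl (i, tr)) else 0) +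
      (if i = lastLayer M.hidden a then x (.inr (.inr v)) else 0) + x (.inr (.inl (i, v))) -
      ∑ tr : A, ∑ j, if nextLayer M.hidden j tr.1.action = i then
          (ok j tr * x (.inl (j, tr))) * (tr.1.target v).toReal else 0 := by
    intro x i v
    simp [L, P, mul_right_comm, -ite_smul]
  have hL2 : ∀ x v, (L x).2 v = x (.inr (.inr v)) := fun x v => rfl
  -- Only these images converge; the preimages `g n` may be unbounded, so compactness would not
  -- suffice.
  let b : ℕ → (Bool × S → ℝ) × (S → ℝ) := fun n =>
    (fun p => if p.1 = false ∧ p.2 = t then 1 else 0, outlet n)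
  have hb : Filter.Tendsto b Filter.atTop
      (nhds (fun p => if p.1 = false ∧ p.2 = t then 1 else 0, fun v => (ν v).toReal)) :=
    tendsto_const_nhds.prodMk_nhds (tendsto_pi_nhds.2 hlim)
  have hmem : ∀ n, b n ∈ L '' {x | 0 ≤ x} := by
    intro n
    have hokg : ∀ i tr, ok i tr * g n i tr = g n i tr := by
      intro i tr
      by_cases h : g n i tr = 0
      · simp [h]
      · simp [ok, hok n i tr h]
    refine ⟨fun
      | .inl (i, tr) => g n i tr
      | .inr (.inl (i, v)) => ((if i = false ∧ v = t then 1 else 0) +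
          ∑ tr : A, ∑ j, if nextLayer M.hidden j tr.1.action = i then
            g n j tr * (tr.1.target v).toReal else 0) -
          (∑ tr : A, (if tr.1.source = v then g n i tr else 0) +
            (if i = lastLayer M.hidden a then outlet n v else 0))
      | .inr (.inr v) => outlet n v, ?_, ?_⟩
    · rintro (⟨i, tr⟩ | ⟨i, v⟩ | v)
      · exact hg n i tr
      · exact sub_nonneg.2 (hle n i v)
      · exact houtlet n v
    · refine Prod.ext (funext fun ⟨i, v⟩ => ?_) (funext fun v => hL2 _ v)
      rw [hL1]
      simp only [hokg, b]
      ring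
  obtain ⟨x, hx, hLx⟩ := L.isClosed_image_nonneg.mem_of_tendsto hb (.of_forall hmem)
  have houtlet' : ∀ v, x (.inr (.inr v)) = (ν v).toReal := fun v => by
    rw [← hL2 x v, hLx]
  have heq : ∀ i v, (if i = false ∧ v = t then 1 else 0) +
      ∑ tr : A, ∑ j, (if nextLayer M.hidden j tr.1.action = i then
          (ok j tr * x (.inl (j, tr))) * (tr.1.target v).toReal else 0) =
      ∑ tr : A, (if tr.1.source = v then ok i tr * x (.inl (i, tr)) else 0) +
      (if i = lastLayer M.hidden a then (ν v).toReal else 0) + x (.inr (.inl (i, v))) := by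
    intro i v
    have := hL1 x i v
    rw [hLx, houtlet'] at this
    simp only at this
    linarith
  -- Summing all vertex equations cancels the internal flow, as each target has mass 1. One unit
  -- enters and the outlet carries off one unit, so nothing is left for the leak.
  have hleak : ∑ i, ∑ v, x (.inr (.inl (i, v))) = 0 := by
    have h1 := sum_sum_ite_next Finset.univ t (fun j (tr : A) => nextLayer M.hidden j tr.1.action)
      (fun tr v => (tr.1.target v).toReal) (fun tr _ => tr.1.target.sum_toReal)
      (fun j tr => ok j tr * x (.inl (j, tr)))
    rw [Finset.sum_congr rfl fun i _ => Finset.sum_congr rfl fun v _ => heq i v] at h1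
    simp_rw [Finset.sum_add_distrib] at h1
    have h2 : ∑ i, ∑ v, (if i = lastLayer M.hidden a then (ν v).toReal else 0) = 1 := by
      rw [Finset.sum_comm]
      simp [PMF.sum_toReal]
    have h3 : ∑ i, ∑ v, ∑ tr : A, (if tr.1.source = v then ok i tr * x (.inl (i, tr)) else 0) =
        ∑ tr : A, ∑ i, ok i tr * x (.inl (i, tr)) := by
      rw [Finset.sum_comm (s := (Finset.univ : Finset A))]
      refine Finset.sum_congr rfl fun i _ => ?_
      rw [Finset.sum_comm]
      simp
    rw [h2, h3] at h1
    linarith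
  have hleak0 : ∀ i v, x (.inr (.inl (i, v))) = 0 := by
    intro i v
    have h1 := (Finset.sum_eq_zero_iff_of_nonneg fun i _ => Finset.sum_nonneg fun v _ =>
      hx (.inr (.inl (i, v)))).1 hleak i (Finset.mem_univ _)
    exact (Finset.sum_eq_zero_iff_of_nonneg fun v _ => hx (.inr (.inl (i, v)))).1 h1 v
      (Finset.mem_univ _)
  refine ⟨fun i tr => ok i tr * x (.inl (i, tr)), ?_, fun v => ENNReal.toReal_nonneg, ?_, ?_⟩
  · intro i tr
    refine mul_nonneg ?_ (hx _)
    simp only [ok]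
    split_ifs <;> simp
  · intro i tr h
    by_contra h'
    simp [ok, h'] at h
  · intro i v
    rw [heq, hleak0, add_zero]

/-! ### From schedulers to flows -/

namespace ProbAutomaton.Scheduler

variable {S Act : Type*} {M : ProbAutomaton S Act}

/-- For each length the total weight is at most 1, so truncated expectations are finite even when
the full ones are not. -/
theorem tsum_weight_len_lt_le [Fintype S] (σ : M.Scheduler) (t : S) (n : ℕ) :
    ∑' α : AltSeq S Act, σ.weight t α * (if α.len < n then 1 else 0) ≤ n := by
  induction n with
  | zero => simp
  | succ n ih =>
    rw [tsum_weight_mul, Nat.cast_succ, add_comm]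
    refine add_le_add ((ENNReal.tsum_le_tsum fun α => ?_).trans ih) (by simp [AltSeq.len])
    refine mul_le_mul_right ?_ _
    simp only [AltSeq.len, Nat.succ_lt_succ_iff, ← Finset.sum_mul, PMF.sum_coe, one_mul]
    exact mul_le_of_le_one_left zero_le (σ.sum_choice_le_one α)

theorem visits_ne_top [Fintype S] (σ : M.Scheduler) (t : S) (a : Act) (n : ℕ) (i : Bool) (v : S) :
    σ.visits t a n i v ≠ ⊤ := by
  refine ne_top_of_le_ne_top (ENNReal.natCast_ne_top n) (le_trans ?_ (σ.tsum_weight_len_lt_le t n))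
  refine ENNReal.tsum_le_tsum fun α => mul_le_mul_right ?_ _
  by_cases h : α.len < n
  · simp only [h, Nat.cast_lt, true_and, if_true]
    split_ifs <;> simp
  · simp [h]

/-- If a scheduler induces an allowed weak combined transition, then so does a finite flow. -/
theorem InducesAllowedWeak.exists_isLayerFlow [Fintype S] {σ : M.Scheduler}
    {A : Finset (PTransition S Act)} (hA : A ⊆ M.trans) {t : S} {a : Act} {ν : PMF S}
    (h : σ.InducesAllowedWeak A t a ν) : ∃ g, IsLayerFlow M A t a g fun v => (ν v).toReal := by
  classical
  have hσA : ∀ α tr, σ.choice α tr ≠ 0 → tr ∈ A := by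
    intro α tr hne
    unfold choice at hne
    split_ifs at hne with hα
    · exact h.2 _ tr (pos_iff_ne_zero.2 hne)
    · exact absurd rfl hne
  have hsum : ∀ n i v, ∑ tr : A, (if tr.1.source = v then σ.choices t a n i tr else 0) +
      σ.halts t a n i v = σ.visits t a n i v := by
    intro n i v
    rw [← σ.sum_choices_add_halts hA hσA, Finset.sum_filter, ← Finset.sum_coe_sort A]
  have hok_fin : ∀ (n : ℕ) i (tr : A), σ.okChoices t a n i tr ≠ ⊤ := by
    intro n i tr
    refine ne_top_of_le_ne_top (σ.visits_ne_top t a n i tr.1.source) ?_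
    refine (σ.okChoices_le_choices t a n i tr).trans ?_
    rw [← hsum]
    refine le_trans ?_ le_self_add
    refine le_trans ?_ (Finset.single_le_sum (fun _ _ => zero_le) (Finset.mem_univ tr))
    simp
  have hhalt_fin : ∀ (n : ℕ) i v, σ.halts t a n i v ≠ ⊤ := fun n i v =>
    ne_top_of_le_ne_top (σ.visits_ne_top t a n i v) (by rw [← hsum]; exact le_add_self)
  -- Sequences with positive stopping probability have the trace of `a`, so restricting to the last
  -- layer loses nothing.
  have hν : ∀ v, σ.halts t a ⊤ (lastLayer M.hidden a) v = ν v := by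
    intro v
    rw [← h.1.last_eq, σ.setProb_eq t fun α => α.last = v]
    refine tsum_congr fun α => ?_
    by_cases hpos : σ.weight t α * σ.halt α = 0
    · rcases mul_eq_zero.1 hpos with h0 | h0 <;> simp [h0]
    · have hα := σ.isFrag_of_weight_ne_zero (left_ne_zero_of_mul hpos)
      have := h.1.trace_eq ⟨α, hα⟩
        (by simpa [fragProb, weight, hα, halt, choice, stopProb, pos_iff_ne_zero] using hpos)
      rw [← layerTrace_lastLayer] at this
      simp [this]
  refine exists_isLayerFlow_of_tendsto (fun n i tr => (σ.okChoices t a n i tr).toReal)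
    (fun n v => (σ.halts t a n (lastLayer M.hidden a) v).toReal) ν
    (fun _ _ _ => ENNReal.toReal_nonneg) (fun _ _ => ENNReal.toReal_nonneg) ?_ ?_ ?_
  · intro n i tr hne
    by_contra hok
    simp [okChoices, hok] at hne
  · intro n i v
    have hle : ∑ tr : A, (if tr.1.source = v then σ.okChoices t a n i tr else 0) +
        (if i = lastLayer M.hidden a then σ.halts t a n (lastLayer M.hidden a) v else 0) ≤
        (if i = false ∧ v = t then 1 else 0) +
        ∑ tr : A, ∑ j, if nextLayer M.hidden j tr.1.action = i then
          σ.okChoices t a n j tr * tr.1.target v else 0 := by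
      have h1 := σ.visits_succ hA hσA t a n i v
      rw [← Finset.sum_coe_sort A] at h1
      rw [← h1]
      -- The choices made during `n` steps feed the visits during `n + 1` steps. The surplus on the
      -- incoming side is part of the leak, as are the choices omitted by `okChoices` and stops
      -- outside the last layer.
      refine le_trans ?_ (σ.visits_mono t a le_self_add i v)
      rw [← hsum]
      refine add_le_add (Finset.sum_le_sum fun tr _ => ?_) ?_
      · split_ifs
        · exact σ.okChoices_le_choices t a n i tr
        · rfl
      · split_ifs with hi
        · rw [hi]
        · exact zero_le
    have hterm : ∀ (tr : A) j, (if nextLayer M.hidden j tr.1.action = i then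
          σ.okChoices t a n j tr * tr.1.target v else 0) ≠ ⊤ := by
      intro tr j
      split_ifs
      · exact ENNReal.mul_ne_top (hok_fin n j tr) (tr.1.target.apply_ne_top v)
      · simp
    have hinit : (if i = false ∧ v = t then (1 : ℝ≥0∞) else 0) ≠ ⊤ := by split_ifs <;> simp
    have hout : ∀ tr : A, (if tr.1.source = v then σ.okChoices t a n i tr else 0) ≠ ⊤ := by
      intro tr
      split_ifs
      · exact hok_fin n i tr
      · simp
    have hhalt : (if i = lastLayer M.hidden a then
        σ.halts t a n (lastLayer M.hidden a) v else 0) ≠ ⊤ := by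
      split_ifs
      · exact hhalt_fin _ _ _
      · simp
    have hin : ∀ tr : A, ∑ j, (if nextLayer M.hidden j tr.1.action = i then
          σ.okChoices t a n j tr * tr.1.target v else 0) ≠ ⊤ :=
      fun tr => ENNReal.sum_ne_top.2 fun j _ => hterm tr j
    have hle' := ENNReal.toReal_mono
      (ENNReal.add_ne_top.2 ⟨hinit, ENNReal.sum_ne_top.2 fun tr _ => hin tr⟩) hle
    rw [ENNReal.toReal_add (ENNReal.sum_ne_top.2 fun tr _ => hout tr) hhalt,
      ENNReal.toReal_add hinit (ENNReal.sum_ne_top.2 fun tr _ => hin tr),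
      ENNReal.toReal_sum fun tr _ => hout tr, ENNReal.toReal_sum fun tr _ => hin tr,
      Finset.sum_congr rfl fun tr _ => ENNReal.toReal_sum fun j _ => hterm tr j] at hle'
    simpa only [apply_ite ENNReal.toReal, ENNReal.toReal_mul, ENNReal.toReal_zero,
      ENNReal.toReal_one] using hle'
  · intro v
    have h1 := σ.tendsto_halts t a (lastLayer M.hidden a) v
    rw [hν] at h1
    exact (ENNReal.tendsto_toReal (ν.apply_ne_top v)).comp h1

end ProbAutomaton.Scheduler

/-! ### Vertex flows in the network -/

namespace NetVertex

variable {S Act : Type*} {R : Setoid S} {A : Finset (PTransition S Act)}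

/-- The vertices as a sum of types. -/
def equivSum : NetVertex R A ≃ Bool ⊕ S ⊕ A ⊕ S ⊕ A ⊕ Quotient R where
  toFun := code
  invFun
    | .inl true => .source
    | .inl false => .sink
    | .inr (.inl v) => .state v
    | .inr (.inr (.inl tr)) => .trans tr
    | .inr (.inr (.inr (.inl v))) => .stateA v
    | .inr (.inr (.inr (.inr (.inl tr)))) => .transA tr
    | .inr (.inr (.inr (.inr (.inr C)))) => .cls C
  left_inv x := by cases x <;> rfl
  right_inv x := by rcases x with (_ | _) | v | tr | v | tr | C <;> rfl

theorem sum_eq [Fintype S] [Fintype (Quotient R)] (F : NetVertex R A → ℝ) :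
    ∑ x, F x = F .source + F .sink + ∑ v, F (.state v) + ∑ tr, F (.trans tr) +
      ∑ v, F (.stateA v) + ∑ tr, F (.transA tr) + ∑ C, F (.cls C) := by
  rw [← equivSum.symm.sum_comp F]
  simp only [Fintype.sum_sum_type, Fintype.sum_bool, equivSum, Equiv.coe_fn_symm_mk]
  ring

end NetVertex

namespace ProbAutomaton

variable {S Act : Type*} (M : ProbAutomaton S Act) (R : Setoid S)
  (A : Finset (PTransition S Act)) (t : S) (a : Act)

/-- Describing arcs by the kinds of their endpoints lets `simp` evaluate the sums over vertices kind
by kind. -/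
theorem netArc_iff (x y : NetVertex R A) : M.NetArc R A t a x y ↔ match x, y with
    | .source, .state v => v = t
    | .cls _, .sink => True
    | .state v, .cls C => a ∈ M.hidden ∧ C = Quotient.mk R v
    | .stateA v, .cls C => a ∉ M.hidden ∧ C = Quotient.mk R v
    | .state v, .trans tr => tr.1.source = v ∧ tr.1.action ∈ M.hidden
    | .trans tr, .state v => tr.1.action ∈ M.hidden ∧ 0 < tr.1.target v
    | .stateA v, .transA tr => tr.1.source = v ∧ a ∉ M.hidden ∧ tr.1.action ∈ M.hidden
    | .state v, .transA tr => tr.1.source = v ∧ a ∉ M.hidden ∧ tr.1.action = a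
    | .transA tr, .stateA v =>
        a ∉ M.hidden ∧ (tr.1.action ∈ M.hidden ∨ tr.1.action = a) ∧ 0 < tr.1.target v
    | _, _ => False := by
  constructor
  · rintro (_ | _ | _ | _ | _ | _ | _ | _ | _ | _) <;> simp_all
  · intro h
    cases x <;> cases y <;> simp only at h
    case source.state v => exact h ▸ .source
    case cls.sink C => exact .sink C
    case state.cls v C => exact h.2 ▸ .stopHidden v h.1
    case stateA.cls v C => exact h.2 ▸ .stopExternal v h.1
    case state.trans v tr => exact h.1 ▸ .hiddenIn tr h.2
    case trans.state tr v => exact .hiddenOut tr v h.1 h.2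
    case stateA.transA v tr => exact h.1 ▸ .hiddenInA tr h.2.1 h.2.2
    case state.transA v tr => exact h.1 ▸ .externalIn tr h.2.1 h.2.2
    case transA.stateA tr v =>
      rcases h.2.1 with h' | h'
      · exact .hiddenOutA tr v h.1 h' h.2.2
      · exact .externalOut tr v h.1 h' h.2.2

section Flow

variable [Fintype S] (f : NetVertex R A → NetVertex R A → ℝ)

open Classical in
theorem inflow_state (v : S) : M.inflow R A t a f (.state v) =
    (if v = t then f .source (.state t) else 0) +
      ∑ tr : A, if tr.1.action ∈ M.hidden ∧ 0 < tr.1.target v then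
        f (.trans tr) (.state v) else 0 := by
  have := Fintype.ofFinite (Quotient R)
  simp only [inflow, Finset.sum_filter, NetVertex.sum_eq, netArc_iff]
  by_cases h : v = t <;> simp [h]
  congr!

open Classical in
theorem inflow_stateA (v : S) : M.inflow R A t a f (.stateA v) =
    ∑ tr : A, if a ∉ M.hidden ∧ (tr.1.action ∈ M.hidden ∨ tr.1.action = a) ∧
      0 < tr.1.target v then f (.transA tr) (.stateA v) else 0 := by
  have := Fintype.ofFinite (Quotient R)
  simp only [inflow, Finset.sum_filter, NetVertex.sum_eq, netArc_iff]
  simp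
  congr!

open Classical in
theorem outflow_state (v : S) : M.outflow R A t a f (.state v) =
    ∑ tr : A, (if tr.1.source = v ∧ tr.1.action ∈ M.hidden then
        f (.state v) (.trans tr) else 0) +
      ∑ tr : A, (if tr.1.source = v ∧ a ∉ M.hidden ∧ tr.1.action = a then
        f (.state v) (.transA tr) else 0) +
      if a ∈ M.hidden then f (.state v) (.cls (Quotient.mk R v)) else 0 := by
  have := Fintype.ofFinite (Quotient R)
  simp only [outflow, Finset.sum_filter, NetVertex.sum_eq, netArc_iff]
  by_cases h : a ∈ M.hidden <;> simp [h] <;> congr!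

open Classical in
theorem outflow_stateA (v : S) : M.outflow R A t a f (.stateA v) =
    ∑ tr : A, (if tr.1.source = v ∧ a ∉ M.hidden ∧ tr.1.action ∈ M.hidden then
        f (.stateA v) (.transA tr) else 0) +
      if a ∉ M.hidden then f (.stateA v) (.cls (Quotient.mk R v)) else 0 := by
  have := Fintype.ofFinite (Quotient R)
  simp only [outflow, Finset.sum_filter, NetVertex.sum_eq, netArc_iff]
  by_cases h : a ∈ M.hidden <;> simp [h]

open Classical in
theorem inflow_trans (tr : A) : M.inflow R A t a f (.trans tr) =
    if tr.1.action ∈ M.hidden then f (.state tr.1.source) (.trans tr) else 0 := by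
  have := Fintype.ofFinite (Quotient R)
  simp only [inflow, Finset.sum_filter, NetVertex.sum_eq, netArc_iff]
  by_cases h : tr.1.action ∈ M.hidden <;> simp [h]

open Classical in
theorem outflow_trans (tr : A) : M.outflow R A t a f (.trans tr) =
    ∑ v, if tr.1.action ∈ M.hidden ∧ 0 < tr.1.target v then
      f (.trans tr) (.state v) else 0 := by
  have := Fintype.ofFinite (Quotient R)
  simp only [outflow, Finset.sum_filter, NetVertex.sum_eq, netArc_iff]
  simp
  congr!

open Classical in
theorem inflow_transA (tr : A) : M.inflow R A t a f (.transA tr) =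
    (if a ∉ M.hidden ∧ tr.1.action = a then f (.state tr.1.source) (.transA tr) else 0) +
    if a ∉ M.hidden ∧ tr.1.action ∈ M.hidden then
      f (.stateA tr.1.source) (.transA tr) else 0 := by
  have := Fintype.ofFinite (Quotient R)
  simp only [inflow, Finset.sum_filter, NetVertex.sum_eq, netArc_iff]
  by_cases h : a ∈ M.hidden <;> by_cases h1 : tr.1.action ∈ M.hidden <;>
    by_cases h2 : tr.1.action = a <;> simp [h, h1, h2]

open Classical in
theorem outflow_transA (tr : A) : M.outflow R A t a f (.transA tr) =
    ∑ v, if a ∉ M.hidden ∧ (tr.1.action ∈ M.hidden ∨ tr.1.action = a) ∧ 0 < tr.1.target v then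
      f (.transA tr) (.stateA v) else 0 := by
  have := Fintype.ofFinite (Quotient R)
  simp only [outflow, Finset.sum_filter, NetVertex.sum_eq, netArc_iff]
  simp
  congr!

open Classical in
theorem inflow_cls (C : Quotient R) : M.inflow R A t a f (.cls C) =
    ∑ v with Quotient.mk R v = C, M.stopFlow R A a f v := by
  have := Fintype.ofFinite (Quotient R)
  simp only [inflow, Finset.sum_filter, NetVertex.sum_eq, netArc_iff, stopFlow]
  by_cases h : a ∈ M.hidden <;> simp only [h, true_and, false_and, not_true, not_false_eq_true,
    if_true, if_false, Finset.sum_const_zero, add_zero, zero_add] <;>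
  · refine Finset.sum_congr rfl fun v _ => ?_
    by_cases hC : C = Quotient.mk R v
    · simp [hC]
    · simp [hC, Ne.symm hC]

open Classical in
theorem outflow_cls (C : Quotient R) : M.outflow R A t a f (.cls C) = f (.cls C) .sink := by
  have := Fintype.ofFinite (Quotient R)
  simp only [outflow, Finset.sum_filter, NetVertex.sum_eq, netArc_iff]
  simp

end Flow

open Classical in
/-- The flow into the transition vertices of a network flow. -/
noncomputable def layerFlow (f : NetVertex R A → NetVertex R A → ℝ) (i : Bool) (tr : A) : ℝ :=
  if LayerOk M.hidden a i tr.1.action then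
    if i = true then f (.stateA tr.1.source) (.transA tr)
    else if tr.1.action ∈ M.hidden then f (.state tr.1.source) (.trans tr)
    else f (.state tr.1.source) (.transA tr)
  else 0

open Classical in
/-- The network flow given by a flow in the two-layer network. -/
noncomputable def networkFlow [Fintype S] (μ : PMF S) (g : Bool → A → ℝ) (outlet : S → ℝ) :
    NetVertex R A → NetVertex R A → ℝ
  | .source, .state _ => 1
  | .cls C, .sink => classProb μ C
  | .state v, .cls _ => outlet v
  | .stateA v, .cls _ => outlet v
  | .state _, .trans tr => g false tr
  | .trans tr, .state v => g false tr * (tr.1.target v).toReal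
  | .stateA _, .transA tr => g true tr
  | .state _, .transA tr => g false tr
  | .transA tr, .stateA v =>
      (if tr.1.action ∈ M.hidden then g true tr else g false tr) * (tr.1.target v).toReal
  | _, _ => 0

end ProbAutomaton

/-! ### Feasible solutions as two-layer flows -/

namespace ProbAutomaton

variable {S Act : Type*} {M : ProbAutomaton S Act} {R : Setoid S}
  {A : Finset (PTransition S Act)} {t : S} {a : Act}

open Classical in
theorem outflow_state_eq [Fintype S] (f : NetVertex R A → NetVertex R A → ℝ) (v : S) :
    M.outflow R A t a f (.state v) =
      ∑ tr : A, (if tr.1.source = v then M.layerFlow R A a f false tr else 0) +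
      if false = lastLayer M.hidden a then M.stopFlow R A a f v else 0 := by
  rw [outflow_state, ← Finset.sum_add_distrib]
  congr 1
  · refine Finset.sum_congr rfl fun tr _ => ?_
    by_cases hv : tr.1.source = v
    · subst hv
      by_cases h : a ∈ M.hidden <;> by_cases h1 : tr.1.action ∈ M.hidden <;>
        by_cases h2 : tr.1.action = a <;> simp_all [layerFlow, LayerOk]
    · simp [hv]
  · by_cases h : a ∈ M.hidden <;> simp [h, lastLayer, stopFlow]

open Classical in
theorem outflow_stateA_eq [Fintype S] (ha : a ∉ M.hidden)
    (f : NetVertex R A → NetVertex R A → ℝ) (v : S) :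
    M.outflow R A t a f (.stateA v) =
      ∑ tr : A, (if tr.1.source = v then M.layerFlow R A a f true tr else 0) +
      if true = lastLayer M.hidden a then M.stopFlow R A a f v else 0 := by
  rw [outflow_stateA]
  congr 1
  · refine Finset.sum_congr rfl fun tr _ => ?_
    by_cases hv : tr.1.source = v
    · subst hv
      by_cases h1 : tr.1.action ∈ M.hidden <;> simp [layerFlow, LayerOk, ha, h1]
    · simp [hv]
  · simp [ha, lastLayer, stopFlow]

theorem toReal_target_eq_zero {tr : PTransition S Act} {v : S} (h : ¬ 0 < tr.target v) :
    (tr.target v).toReal = 0 := by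
  rw [not_lt, nonpos_iff_eq_zero] at h
  simp [h]

-- The balance equations express the arcs out of `v^tr` through the arc into it. Extending the sum
-- to states outside the support adds only zero terms.
open Classical in
theorem inflow_state_eq [Fintype S] {f : NetVertex R A → NetVertex R A → ℝ}
    (hsrc : f .source (.state t) = 1)
    (hbal : ∀ (tr : A) (v : S), tr.1.action ∈ M.hidden → 0 < tr.1.target v →
      f (.trans tr) (.state v) - (tr.1.target v).toReal * f (.state tr.1.source) (.trans tr) = 0)
    (v : S) :
    M.inflow R A t a f (.state v) = (if false = false ∧ v = t then 1 else 0) +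
      ∑ tr : A, ∑ j, if nextLayer M.hidden j tr.1.action = false then
        M.layerFlow R A a f j tr * (tr.1.target v).toReal else 0 := by
  rw [inflow_state, hsrc]
  congr 1
  · simp
  · refine Finset.sum_congr rfl fun tr _ => ?_
    by_cases h : tr.1.action ∈ M.hidden
    · by_cases hv : 0 < tr.1.target v
      · have := hbal tr v h hv
        simp only [Fintype.sum_bool, nextLayer, h, hv, layerFlow, LayerOk]
        simp
        linarith
      · simp [hv, toReal_target_eq_zero hv]
    · simp [h, nextLayer]

open Classical in
theorem inflow_stateA_eq [Fintype S] {f : NetVertex R A → NetVertex R A → ℝ}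
    (ha : a ∉ M.hidden)
    (hbal : ∀ (tr : A) (v : S), tr.1.action ∈ M.hidden → 0 < tr.1.target v →
      f (.transA tr) (.stateA v) -
        (tr.1.target v).toReal * f (.stateA tr.1.source) (.transA tr) = 0)
    (hbal' : ∀ (tr : A) (v : S), tr.1.action = a → 0 < tr.1.target v →
      f (.transA tr) (.stateA v) -
        (tr.1.target v).toReal * f (.state tr.1.source) (.transA tr) = 0) (v : S) :
    M.inflow R A t a f (.stateA v) = (if true = false ∧ v = t then 1 else 0) +
      ∑ tr : A, ∑ j, if nextLayer M.hidden j tr.1.action = true then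
        M.layerFlow R A a f j tr * (tr.1.target v).toReal else 0 := by
  rw [inflow_stateA, if_neg (by simp), zero_add]
  refine Finset.sum_congr rfl fun tr _ => ?_
  by_cases hv : 0 < tr.1.target v
  · by_cases h : tr.1.action ∈ M.hidden
    · have := hbal tr v h hv
      simp only [Fintype.sum_bool, nextLayer, h, hv, ha, layerFlow, LayerOk]
      simp
      linarith
    · by_cases h2 : tr.1.action = a
      · have := hbal' tr v h2 hv
        simp only [Fintype.sum_bool, nextLayer, hv, h2, ha, layerFlow, LayerOk]
        simp
        linarith
      · simp [h, h2, layerFlow, LayerOk]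
  · simp [hv, toReal_target_eq_zero hv]

namespace LPFeasible

variable [Fintype S] {μ : PMF S} {f : NetVertex R A → NetVertex R A → ℝ}

theorem inflow_eq_outflow (hf : M.LPFeasible R A t a μ f) {x : NetVertex R A}
    (hx : x ∈ M.netVertices R A a) (h1 : x ≠ .source) (h2 : x ≠ .sink) :
    M.inflow R A t a f x = M.outflow R A t a f x :=
  sub_eq_zero.1 (hf.conservation x hx h1 h2)

open Classical in
theorem isLayerFlow (hf : M.LPFeasible R A t a μ f) :
    IsLayerFlow M A t a (M.layerFlow R A a f) (M.stopFlow R A a f) where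
  nonneg i tr := by
    unfold layerFlow
    split_ifs with h h1 h2
    · refine hf.nonneg _ _ ((M.netArc_iff R A t a _ _).2 ?_)
      subst h1
      simpa [LayerOk, and_comm] using h
    · exact hf.nonneg _ _ ((M.netArc_iff R A t a _ _).2 ⟨rfl, h2⟩)
    · refine hf.nonneg _ _ ((M.netArc_iff R A t a _ _).2 ?_)
      rcases h with h | h
      · exact absurd h.1 h2
      · exact ⟨rfl, h.2⟩
    · rfl
  outlet_nonneg v := by
    unfold stopFlow
    split_ifs with h
    · exact hf.nonneg _ _ (.stopHidden v h)
    · exact hf.nonneg _ _ (.stopExternal v h)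
  ok i tr h := by
    by_contra h'
    simp [layerFlow, h'] at h
  conservation i v := by
    cases i
    · rw [← inflow_state_eq hf.source_eq hf.balance_hidden, ← outflow_state_eq (t := t)]
      exact hf.inflow_eq_outflow trivial (by simp) (by simp)
    -- For hidden `a` the second layer has no vertices in the network, but the equation still holds,
    -- with both sides zero.
    · by_cases ha : a ∈ M.hidden
      · have h1 : ∀ tr : A, (if tr.1.source = v then M.layerFlow R A a f true tr else 0) = 0 := by
          intro tr
          simp [layerFlow, LayerOk, ha]
        have h2 : ∀ (tr : A) (j : Bool), (if nextLayer M.hidden j tr.1.action = true then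
            M.layerFlow R A a f j tr * (tr.1.target v).toReal else 0) = 0 := by
          intro tr j
          cases j <;> by_cases h : tr.1.action ∈ M.hidden <;>
            simp [layerFlow, LayerOk, ha, nextLayer, h]
        simp [h1, h2, lastLayer, ha]
      · rw [← inflow_stateA_eq ha (hf.balance_hiddenA ha) (hf.balance_external ha), ← outflow_stateA_eq (t := t) ha]
        exact hf.inflow_eq_outflow ha (by simp) (by simp)

open Classical in
theorem sum_stopFlow (hf : M.LPFeasible R A t a μ f) (C : Quotient R) :
    ∑ v with Quotient.mk R v = C, M.stopFlow R A a f v = classProb μ C := by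
  rw [← inflow_cls (t := t), hf.inflow_eq_outflow (x := .cls C) trivial (by simp) (by simp),
    outflow_cls, hf.class_eq]

end LPFeasible

-- Conservation at state vertices is that of the given flow, at transition vertices it holds because
-- targets have mass 1, and at classes it is the hypothesis on the outlet.
open Classical in
theorem _root_.IsLayerFlow.lpFeasible [Fintype S] {μ : PMF S} {g : Bool → A → ℝ} {outlet : S → ℝ}
    (hg : IsLayerFlow M A t a g outlet)
    (hμ : ∀ C : Quotient R, ∑ v with Quotient.mk R v = C, outlet v = classProb μ C) :
    M.LPFeasible R A t a μ (M.networkFlow R A μ g outlet) := by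
  have hg0 : ∀ i (tr : A), ¬ LayerOk M.hidden a i tr.1.action → g i tr = 0 :=
    fun i tr h => not_ne_iff.1 (mt (hg.ok i tr) h)
  have hbal : ∀ (tr : A) (v : S), tr.1.action ∈ M.hidden → 0 < tr.1.target v →
      M.networkFlow R A μ g outlet (.trans tr) (.state v) - (tr.1.target v).toReal *
        M.networkFlow R A μ g outlet (.state tr.1.source) (.trans tr) = 0 := by
    intro tr v _ _
    simp only [networkFlow]
    ring
  have hbalA : a ∉ M.hidden → ∀ (tr : A) (v : S), tr.1.action ∈ M.hidden →
      0 < tr.1.target v →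
      M.networkFlow R A μ g outlet (.transA tr) (.stateA v) - (tr.1.target v).toReal *
        M.networkFlow R A μ g outlet (.stateA tr.1.source) (.transA tr) = 0 := by
    intro _ tr v h _
    simp only [networkFlow, h, if_true]
    ring
  have hbalE : a ∉ M.hidden → ∀ (tr : A) (v : S), tr.1.action = a → 0 < tr.1.target v →
      M.networkFlow R A μ g outlet (.transA tr) (.stateA v) - (tr.1.target v).toReal *
        M.networkFlow R A μ g outlet (.state tr.1.source) (.transA tr) = 0 := by
    intro ha tr v h _
    simp only [networkFlow, h, ha, if_false]
    ring
  have hlayer : M.layerFlow R A a (M.networkFlow R A μ g outlet) = g := by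
    funext i tr
    unfold layerFlow
    split_ifs with h h1 h2
    · rw [h1]; rfl
    · rw [Bool.not_eq_true] at h1
      rw [h1]; rfl
    · rw [Bool.not_eq_true] at h1
      rw [h1]; rfl
    · exact (hg0 i tr h).symm
  have houtlet : M.stopFlow R A a (M.networkFlow R A μ g outlet) = outlet := by
    funext v
    unfold stopFlow
    split_ifs <;> rfl
  have hsum : ∀ (tr : A) (c : ℝ),
      ∑ v, (if 0 < tr.1.target v then c * (tr.1.target v).toReal else 0) = c := by
    intro tr c
    conv_rhs => rw [← mul_one c, ← tr.1.target.sum_toReal, Finset.mul_sum]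
    refine Finset.sum_congr rfl fun v _ => ?_
    split_ifs with h
    · rfl
    · rw [toReal_target_eq_zero h, mul_zero]
  refine ⟨?_, rfl, fun C => rfl, ?_, hbal, hbalA, hbalE⟩
  · rintro _ _ (_ | _ | _ | _ | _ | _ | _ | _ | _ | _)
    · exact zero_le_one
    · exact Finset.sum_nonneg fun v _ => ENNReal.toReal_nonneg
    · exact hg.outlet_nonneg _
    · exact hg.outlet_nonneg _
    · exact hg.nonneg _ _
    · exact mul_nonneg (hg.nonneg _ _) ENNReal.toReal_nonneg
    · exact hg.nonneg _ _
    · refine mul_nonneg ?_ ENNReal.toReal_nonneg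
      split_ifs
      exact hg.nonneg _ _
    · exact hg.nonneg _ _
    · refine mul_nonneg ?_ ENNReal.toReal_nonneg
      split_ifs <;> exact hg.nonneg _ _
  · rintro (_ | _ | v | tr | v | tr | C) hx h1 h2
    · exact absurd rfl h1
    · exact absurd rfl h2
    · rw [inflow_state_eq rfl hbal, outflow_state_eq, hlayer, houtlet, hg.conservation, sub_self]
    · rw [inflow_trans, outflow_trans]
      by_cases h : tr.1.action ∈ M.hidden
      · simp only [h, true_and, if_true, networkFlow, hsum, sub_self]
      · simp [h]
    · have ha : a ∉ M.hidden := hx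
      rw [inflow_stateA_eq ha (hbalA ha) (hbalE ha), outflow_stateA_eq ha, hlayer, houtlet,
        hg.conservation, sub_self]
    · obtain ⟨ha, h⟩ : a ∉ M.hidden ∧ (tr.1.action = a ∨ tr.1.action ∈ M.hidden) := hx
      rw [inflow_transA, outflow_transA]
      by_cases h' : tr.1.action ∈ M.hidden
      · have hne : tr.1.action ≠ a := fun h => ha (h ▸ h')
        simp [ha, h', hne, networkFlow, hsum]
      · have heq := h.resolve_right h'
        simp [ha, heq, networkFlow, hsum]
    · rw [inflow_cls, outflow_cls, houtlet, hμ]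
      exact sub_self _

end ProbAutomaton

/-! ### Lifting an equivalence relation -/

open Classical in
/-- Two distributions are related by the lifting of an equivalence relation iff they agree on the
equivalence classes. -/
theorem liftRel_iff_sum_eq_classProb {S : Type*} [Fintype S] (R : Setoid S) (μ ν : PMF S) :
    LiftRel R.r μ ν ↔ ∀ C : Quotient R,
      ∑ v with Quotient.mk R v = C, (ν v).toReal = ProbAutomaton.classProb μ C := by
  have hreal : (∀ C : Quotient R,
      ∑ v with Quotient.mk R v = C, (ν v).toReal = ProbAutomaton.classProb μ C) ↔
      ∀ C : Quotient R, ∑ v with Quotient.mk R v = C, ν v = ∑ v with Quotient.mk R v = C, μ v := by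
    refine forall_congr' fun C => ?_
    unfold ProbAutomaton.classProb
    rw [← ENNReal.toReal_sum fun v _ => ν.apply_ne_top v,
      ← ENNReal.toReal_sum fun v _ => μ.apply_ne_top v]
    exact ENNReal.toReal_eq_toReal_iff' (ENNReal.sum_ne_top.2 fun v _ => ν.apply_ne_top v)
      (ENNReal.sum_ne_top.2 fun v _ => μ.apply_ne_top v)
  rw [hreal]
  constructor
  · rintro ⟨w, -, hw, h1, h2⟩ C
    simp_rw [← h1, ← h2, tsum_fintype]
    have hzero : ∀ x y, Quotient.mk R x ≠ Quotient.mk R y → w x y = 0 := by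
      intro x y h
      by_contra h0
      exact h (Quotient.sound (hw x y (pos_iff_ne_zero.2 h0)))
    rw [Finset.sum_comm]
    simp_rw [Finset.sum_filter]
    refine Finset.sum_congr rfl fun x _ => ?_
    split_ifs with hx
    · refine Finset.sum_congr rfl fun y _ => ?_
      split_ifs with hy
      · rfl
      · exact (hzero x y fun h => hy (h ▸ hx)).symm
    · refine Finset.sum_eq_zero fun y _ => ?_
      split_ifs with hy
      · exact hzero x y fun h => hx (h.trans hy)
      · rfl
  · intro h
    let m : S → ℝ≥0∞ := fun x => ∑ v with Quotient.mk R v = Quotient.mk R x, μ v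
    have hm_top : ∀ x, m x ≠ ⊤ := fun x => ENNReal.sum_ne_top.2 fun v _ => μ.apply_ne_top v
    have hμm : ∀ x, μ x ≤ m x := fun x =>
      Finset.single_le_sum (f := fun v => μ v) (fun _ _ => zero_le) (by simp)
    have hνm : ∀ x, ν x ≤ m x := fun x => by
      simp only [m]
      rw [← h]
      exact Finset.single_le_sum (f := fun v => ν v) (fun _ _ => zero_le) (by simp)
    have hcongr : ∀ x y, Quotient.mk R x = Quotient.mk R y → m x = m y := by
      intro x y hxy
      simp only [m, hxy]
    -- A class of mass zero is harmless: there both sides are 0.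
    have hcancel : ∀ (p : PMF S) x, p x ≤ m x → p x * m x / m x = p x := by
      intro p x hle
      by_cases h0 : m x = 0
      · have : p x = 0 := le_zero_iff.1 (hle.trans h0.le)
        simp [this]
      · exact ENNReal.mul_div_cancel_right h0 (hm_top x)
    -- Within each class this is the independent coupling, normalized by the class mass `m x`.
    refine ⟨fun x y => if Quotient.mk R x = Quotient.mk R y then μ x * ν y / m x else 0,
      ?_, ?_, ?_, ?_⟩
    · intro x y
      dsimp only
      split_ifs with hxy
      · refine ENNReal.div_le_of_le_mul ?_
        have h1 : ν y ≤ 1 := ν.coe_le_one y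
        calc μ x * ν y ≤ m x * 1 := mul_le_mul' (hμm x) h1
          _ = 1 * m x := mul_comm _ _
      · exact zero_le
    · intro x y hpos
      by_contra hxy
      have : Quotient.mk R x ≠ Quotient.mk R y := fun h => hxy (Quotient.exact h)
      simp [this] at hpos
    · intro x
      rw [tsum_fintype, ← Finset.sum_filter]
      simp_rw [mul_div_assoc, ← Finset.mul_sum, div_eq_mul_inv, ← Finset.sum_mul]
      have : ∑ y with Quotient.mk R x = Quotient.mk R y, ν y = m x := by
        simp only [m]
        rw [← h]
        simp_rw [eq_comm]
      rw [this, ← div_eq_mul_inv, ← mul_div_assoc]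
      exact hcancel μ x (hμm x)
    · intro y
      rw [tsum_fintype, ← Finset.sum_filter]
      rw [Finset.sum_congr rfl fun x hx => by rw [hcongr x y (Finset.mem_filter.1 hx).2]]
      simp_rw [div_eq_mul_inv, mul_assoc, ← Finset.sum_mul]
      rw [← mul_assoc, ← div_eq_mul_inv, mul_comm]
      have := hcancel ν y (hνm y)
      exact this

/-! ### Existence of optimal solutions -/

namespace ProbAutomaton

variable {S Act : Type*} {M : ProbAutomaton S Act} {R : Setoid S}
  {A : Finset (PTransition S Act)} {t : S} {a : Act}

open Classical in
/-- The constraints concern only the arcs. -/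
theorem LPFeasible.congr [Fintype S] {μ : PMF S} {f g : NetVertex R A → NetVertex R A → ℝ}
    (hf : M.LPFeasible R A t a μ f) (h : ∀ x y, M.NetArc R A t a x y → g x y = f x y) :
    M.LPFeasible R A t a μ g where
  nonneg x y hxy := by rw [h x y hxy]; exact hf.nonneg x y hxy
  source_eq := by rw [h _ _ .source, hf.source_eq]
  class_eq C := by rw [h _ _ (.sink C), hf.class_eq]
  conservation x hx h1 h2 := by
    rw [← hf.conservation x hx h1 h2]
    unfold inflow outflow
    congr 1
    · exact Finset.sum_congr rfl fun y hy => h y x (Finset.mem_filter.1 hy).2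
    · exact Finset.sum_congr rfl fun y hy => h x y (Finset.mem_filter.1 hy).2
  balance_hidden tr v h1 h2 := by
    rw [h _ _ (.hiddenOut tr v h1 h2), h _ _ (.hiddenIn tr h1), hf.balance_hidden tr v h1 h2]
  balance_hiddenA ha tr v h1 h2 := by
    rw [h _ _ (.hiddenOutA tr v ha h1 h2), h _ _ (.hiddenInA tr ha h1),
      hf.balance_hiddenA ha tr v h1 h2]
  balance_external ha tr v h1 h2 := by
    rw [h _ _ (.externalOut tr v ha h1 h2), h _ _ (.externalIn tr ha h1),
      hf.balance_external ha tr v h1 h2]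

/-- All constraints are equations or weak inequalities between continuous functions of `f`. -/
theorem isClosed_setOf_lpFeasible [Fintype S] (μ : PMF S) :
    IsClosed {f : NetVertex R A → NetVertex R A → ℝ | M.LPFeasible R A t a μ f} := by
  have hiff : ∀ f : NetVertex R A → NetVertex R A → ℝ, M.LPFeasible R A t a μ f ↔
      (∀ x y, M.NetArc R A t a x y → 0 ≤ f x y) ∧ f .source (.state t) = 1 ∧
      (∀ C : Quotient R, f (.cls C) .sink = classProb μ C) ∧
      (∀ x ∈ M.netVertices R A a, x ≠ .source → x ≠ .sink →
        M.inflow R A t a f x - M.outflow R A t a f x = 0) ∧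
      (∀ (tr : A) (v : S), tr.1.action ∈ M.hidden → 0 < tr.1.target v →
        f (.trans tr) (.state v) -
          (tr.1.target v).toReal * f (.state tr.1.source) (.trans tr) = 0) ∧
      (a ∉ M.hidden → ∀ (tr : A) (v : S), tr.1.action ∈ M.hidden → 0 < tr.1.target v →
        f (.transA tr) (.stateA v) -
          (tr.1.target v).toReal * f (.stateA tr.1.source) (.transA tr) = 0) ∧
      (a ∉ M.hidden → ∀ (tr : A) (v : S), tr.1.action = a → 0 < tr.1.target v →
        f (.transA tr) (.stateA v) -
          (tr.1.target v).toReal * f (.state tr.1.source) (.transA tr) = 0) :=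
    fun f => ⟨fun h => ⟨h.1, h.2, h.3, h.4, h.5, h.6, h.7⟩,
      fun ⟨h1, h2, h3, h4, h5, h6, h7⟩ => ⟨h1, h2, h3, h4, h5, h6, h7⟩⟩
  simp_rw [hiff, Set.ofPred_and, Set.ofPred_forall]
  unfold inflow outflow
  refine IsClosed.inter ?_ (IsClosed.inter ?_ (IsClosed.inter ?_ (IsClosed.inter ?_
    (IsClosed.inter ?_ (IsClosed.inter ?_ ?_)))))
  all_goals
    repeat' first
      | exact isClosed_le (by fun_prop) (by fun_prop)
      | exact isClosed_eq (by fun_prop) (by fun_prop)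
      | refine isClosed_iInter fun _ => ?_

open Classical in
/-- A feasible LP problem has an optimal solution. -/
theorem LPFeasible.exists_lpOptimal [Fintype S] {μ : PMF S}
    {f₀ : NetVertex R A → NetVertex R A → ℝ} (hf₀ : M.LPFeasible R A t a μ f₀) :
    ∃ f, M.LPOptimal R A t a μ f := by
  -- Values off the arcs are unconstrained and would spoil compactness, so they are set to 0.
  let restr : (NetVertex R A → NetVertex R A → ℝ) → NetVertex R A → NetVertex R A → ℝ :=
    fun f x y => if M.NetArc R A t a x y then f x y else 0
  have hrestr : ∀ f x y, M.NetArc R A t a x y → restr f x y = f x y := fun f x y h => if_pos h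
  have hobj : ∀ f, M.lpObjective R A t a (restr f) = M.lpObjective R A t a f := by
    intro f
    refine Finset.sum_congr rfl fun e he => ?_
    rw [hrestr f e.1 e.2 (Finset.mem_filter.1 he).2]
  have hcont : Continuous (M.lpObjective R A t a) := by
    unfold lpObjective
    fun_prop
  -- Flows on arcs are nonnegative, so each is at most minus the objective, hence at most minus the
  -- objective of `f₀` on the superlevel set.
  let K : Set (NetVertex R A → NetVertex R A → ℝ) :=
    {f | M.LPFeasible R A t a μ f} ∩ {f | M.lpObjective R A t a f₀ ≤ M.lpObjective R A t a f} ∩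
      Set.Icc 0 fun _ _ => -M.lpObjective R A t a f₀
  have hK : IsCompact K := by
    refine isCompact_Icc.inter_left ?_
    exact (isClosed_setOf_lpFeasible μ).inter (isClosed_le continuous_const hcont)
  have hmem : ∀ f, M.LPFeasible R A t a μ f →
      M.lpObjective R A t a f₀ ≤ M.lpObjective R A t a f → restr f ∈ K := by
    intro f hf hle
    have hnn : ∀ e ∈ ({e | M.NetArc R A t a e.1 e.2} : Finset (NetVertex R A × NetVertex R A)),
        0 ≤ f e.1 e.2 := fun e he => hf.nonneg _ _ (Finset.mem_filter.1 he).2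
    have h0 : 0 ≤ -M.lpObjective R A t a f := by
      simpa [lpObjective] using Finset.sum_nonneg hnn
    refine ⟨⟨hf.congr (hrestr f), hle.trans_eq (hobj f).symm⟩, fun x y => ?_, fun x y => ?_⟩
    · simp only [restr, Pi.zero_apply]
      split_ifs with h
      · exact hf.nonneg x y h
      · rfl
    · refine le_trans ?_ (neg_le_neg hle)
      simp only [restr]
      split_ifs with h
      · have := Finset.single_le_sum hnn (show (x, y) ∈ _ by simpa using h)
        simpa [lpObjective] using this
      · exact h0
  obtain ⟨f, hfK, hmax⟩ := hK.exists_isMaxOn ⟨_, hmem f₀ hf₀ le_rfl⟩ hcont.continuousOn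
  refine ⟨f, hfK.1.1, fun g hg => ?_⟩
  rcases le_total (M.lpObjective R A t a f₀) (M.lpObjective R A t a g) with h | h
  · rw [← hobj g]
    exact hmax (hmem g hg h)
  · exact h.trans hfK.1.2

end ProbAutomaton

/-! ### The scheduler built from a feasible solution -/

namespace ProbAutomaton

variable {S Act : Type*} {M : ProbAutomaton S Act} {R : Setoid S}
  {A : Finset (PTransition S Act)} {t : S} {a : Act}

variable (M R A a) in
open Classical in
/-- The total flow out of the state `v` in layer `i`. -/
noncomputable def layerOutflow [Fintype S] (f : NetVertex R A → NetVertex R A → ℝ) (i : Bool)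
    (v : S) : ℝ :=
  ∑ tr : A, (if tr.1.source = v then M.layerFlow R A a f i tr else 0) +
    if i = lastLayer M.hidden a then M.stopFlow R A a f v else 0

section

variable [Fintype S] {μ : PMF S} {f : NetVertex R A → NetVertex R A → ℝ}

theorem flowChoice_ne_zero {α : M.FinFrag} {tr : PTransition S Act}
    (h : M.flowChoice R A t a f α tr ≠ 0) : tr ∈ A ∧ tr.source = α.1.last ∧
      ∃ i, α.1.trace M.hidden = layerTrace a i ∧ LayerOk M.hidden a i tr.action := by
  unfold flowChoice at h
  split_ifs at h with h1 h2 h3 h4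
  · exact ⟨h1.1, h1.2, false, h2.1, .inl ⟨h2.2, .inl rfl⟩⟩
  · exact ⟨h1.1, h1.2, false, h3.1, .inr ⟨rfl, h3.2⟩⟩
  · exact ⟨h1.1, h1.2, true, h4.1, .inl ⟨h4.2.2, .inr h4.2.1⟩⟩
  · exact absurd rfl h
  · exact absurd rfl h

theorem LPFeasible.flowChoice_eq (hf : M.LPFeasible R A t a μ f) {α : M.FinFrag}
    {tr : PTransition S Act} {i : Bool} (hi : α.1.trace M.hidden = layerTrace a i)
    (htr : tr ∈ A) (hs : tr.source = α.1.last) : M.flowChoice R A t a f α tr =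
      M.layerFlow R A a f i ⟨tr, htr⟩ / M.layerOutflow R A a f i α.1.last := by
  have h0 : M.inflow R A t a f (.state α.1.last) = M.layerOutflow R A a f false α.1.last := by
    rw [hf.inflow_eq_outflow (x := .state _) trivial (by simp) (by simp), outflow_state_eq, layerOutflow]
  unfold flowChoice
  rw [dif_pos ⟨htr, hs⟩, h0]
  simp only [← hs]
  cases i
  · have hi' : α.1.trace M.hidden = [] := hi
    by_cases h1 : tr.action ∈ M.hidden
    · simp [hi', h1, layerFlow, LayerOk]
    · by_cases h2 : a ∉ M.hidden ∧ tr.action = a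
      · simp [hi', h2, layerFlow, LayerOk]
      · simp [hi', h1, h2, layerFlow, LayerOk]
  · have hi' : α.1.trace M.hidden = [a] := hi
    by_cases h1 : a ∉ M.hidden ∧ tr.action ∈ M.hidden
    · have h2 : M.inflow R A t a f (.stateA tr.source) =
          M.layerOutflow R A a f true tr.source := by
        rw [hf.inflow_eq_outflow (x := .stateA tr.source) h1.1 (by simp) (by simp),
          outflow_stateA_eq h1.1, layerOutflow]
      simp [hi', h1, h2, layerFlow, LayerOk]
    · rw [and_comm] at h1
      simp [hi', layerFlow, LayerOk, h1]
      tauto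

theorem LPFeasible.layerFlow_nonneg (hf : M.LPFeasible R A t a μ f) (i : Bool) (tr : A) :
    0 ≤ M.layerFlow R A a f i tr :=
  hf.isLayerFlow.nonneg i tr

open Classical in
theorem LPFeasible.sum_layerFlow_le (hf : M.LPFeasible R A t a μ f) (i : Bool) (v : S) :
    ∑ tr : A, (if tr.1.source = v then M.layerFlow R A a f i tr else 0) ≤
      M.layerOutflow R A a f i v := by
  refine le_add_of_nonneg_right ?_
  split_ifs
  · exact hf.isLayerFlow.outlet_nonneg v
  · rfl

theorem LPFeasible.layerOutflow_nonneg (hf : M.LPFeasible R A t a μ f) (i : Bool) (v : S) :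
    0 ≤ M.layerOutflow R A a f i v := by
  classical
  refine le_trans (Finset.sum_nonneg fun tr _ => ?_) (hf.sum_layerFlow_le i v)
  split_ifs
  · exact hf.layerFlow_nonneg i tr
  · rfl

/-- A nonnegative summand of a zero outflow vanishes; this justifies the convention `x / 0 = 0` in
the choice probabilities. -/
theorem LPFeasible.layerFlow_eq_zero (hf : M.LPFeasible R A t a μ f) {i : Bool} {tr : A}
    (h : M.layerOutflow R A a f i tr.1.source = 0) : M.layerFlow R A a f i tr = 0 := by
  classical
  refine le_antisymm ?_ (hf.layerFlow_nonneg i tr)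
  rw [← h]
  refine le_trans ?_ (hf.sum_layerFlow_le i _)
  refine le_trans ?_ (Finset.single_le_sum (f := fun tr' : A =>
    if tr'.1.source = tr.1.source then M.layerFlow R A a f i tr' else 0) (fun tr' _ => ?_)
    (Finset.mem_univ tr))
  · simp
  · split_ifs
    · exact hf.layerFlow_nonneg i tr'
    · rfl

/-- The scheduler built from a feasible solution. -/
noncomputable def LPFeasible.scheduler (hf : M.LPFeasible R A t a μ f) (hA : A ⊆ M.trans) :
    M.Scheduler where
  prob α tr := ENNReal.ofReal (M.flowChoice R A t a f α tr)
  enabled α tr h := by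
    have h' : M.flowChoice R A t a f α tr ≠ 0 := by
      rintro h0
      simp [h0] at h
    obtain ⟨h1, h2, -⟩ := flowChoice_ne_zero h'
    exact ⟨hA h1, h2⟩
  sum_le_one α := by
    classical
    have hzero : ∀ tr ∈ M.trans, tr ∉ A →
        ENNReal.ofReal (M.flowChoice R A t a f α tr) = 0 := by
      intro tr _ htr
      rw [not_ne_iff.1 (mt (fun h => (flowChoice_ne_zero h).1) htr), ENNReal.ofReal_zero]
    rw [← Finset.sum_subset hA hzero]
    -- After a trace of neither layer the scheduler stops, so the sum is 0.
    by_cases hi : ∃ i, α.1.trace M.hidden = layerTrace a i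
    · obtain ⟨i, hi⟩ := hi
      have hterm : ∀ tr : A, ENNReal.ofReal (M.flowChoice R A t a f α tr) = ENNReal.ofReal
          ((if tr.1.source = α.1.last then M.layerFlow R A a f i tr else 0) /
            M.layerOutflow R A a f i α.1.last) := by
        intro tr
        split_ifs with hs
        · rw [hf.flowChoice_eq hi tr.2 hs]
        · rw [not_ne_iff.1 (mt (fun h => (flowChoice_ne_zero h).2.1) hs), zero_div]
      have hnn : ∀ tr : A, 0 ≤ if tr.1.source = α.1.last then M.layerFlow R A a f i tr else 0 := by
        intro tr
        split_ifs
        · exact hf.layerFlow_nonneg i tr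
        · rfl
      rw [← Finset.sum_coe_sort A, Finset.sum_congr rfl fun tr _ => hterm tr,
        ← ENNReal.ofReal_sum_of_nonneg fun tr _ =>
          div_nonneg (hnn tr) (hf.layerOutflow_nonneg i _), ← Finset.sum_div]
      exact ENNReal.ofReal_le_one.2
        (div_le_one_of_le₀ (hf.sum_layerFlow_le i _) (hf.layerOutflow_nonneg i _))
    · rw [Finset.sum_eq_zero fun tr _ => ?_]
      · exact zero_le
      · by_contra h
        have h' : M.flowChoice R A t a f α tr ≠ 0 := by
          rintro h0
          simp [h0] at h
        obtain ⟨-, -, i, h1, -⟩ := flowChoice_ne_zero h'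
        exact hi ⟨i, h1⟩

theorem LPFeasible.determinate_scheduler (hf : M.LPFeasible R A t a μ f) (hA : A ⊆ M.trans) :
    (hf.scheduler hA).Determinate := by
  intro α α' h1 h2
  funext tr
  simp only [scheduler, flowChoice, h1, h2]
  congr!

open Classical in
theorem sum_classProb [Fintype (Quotient R)] (μ : PMF S) :
    ∑ C : Quotient R, classProb μ C = 1 := by
  rw [← μ.sum_toReal]
  exact Finset.sum_fiberwise _ _ _

/-- The flow out of the states passes through the classes, whose outgoing arcs carry the masses of
`μ`. -/
theorem LPFeasible.sum_stopFlow_eq_one (hf : M.LPFeasible R A t a μ f) :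
    ∑ v, M.stopFlow R A a f v = 1 := by
  classical
  have := Fintype.ofFinite (Quotient R)
  rw [← sum_classProb (R := R) μ, ← Finset.sum_fiberwise _ (Quotient.mk R)]
  exact Finset.sum_congr rfl fun C _ => by rw [← hf.sum_stopFlow C]

/-- The distribution on the states in which the flow of a feasible solution stops. -/
noncomputable def LPFeasible.stopPMF (hf : M.LPFeasible R A t a μ f) : PMF S :=
  PMF.ofFintype (fun v => ENNReal.ofReal (M.stopFlow R A a f v)) <| by
    rw [← ENNReal.ofReal_sum_of_nonneg fun v _ => hf.isLayerFlow.outlet_nonneg v,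
      hf.sum_stopFlow_eq_one, ENNReal.ofReal_one]

theorem LPFeasible.stopPMF_apply (hf : M.LPFeasible R A t a μ f) (v : S) :
    hf.stopPMF v = ENNReal.ofReal (M.stopFlow R A a f v) :=
  rfl

theorem LPFeasible.liftRel_stopPMF (hf : M.LPFeasible R A t a μ f) :
    LiftRel R.r μ hf.stopPMF := by
  classical
  rw [liftRel_iff_sum_eq_classProb]
  intro C
  rw [← hf.sum_stopFlow C]
  refine Finset.sum_congr (by congr!) fun v _ => ?_
  rw [hf.stopPMF_apply, ENNReal.toReal_ofReal (hf.isLayerFlow.outlet_nonneg v)]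

/-- The criterion `inducesAllowedWeak_of_flow`, with the layer outflow as `F` and the layer flow,
extended by 0 outside `A`, as `g`. -/
theorem LPFeasible.inducesAllowedWeak (hf : M.LPFeasible R A t a μ f) (hA : A ⊆ M.trans) :
    (hf.scheduler hA).InducesAllowedWeak A t a hf.stopPMF := by
  classical
  have hchoice : ∀ (α : AltSeq S Act) tr, (hf.scheduler hA).choice α tr ≠ 0 →
      ∃ h : M.IsFrag α, M.flowChoice R A t a f ⟨α, h⟩ tr ≠ 0 := by
    intro α tr h
    unfold Scheduler.choice at h
    split_ifs at h with hα
    · refine ⟨hα, fun h0 => h ?_⟩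
      simp [scheduler, h0]
    · exact absurd rfl h
  let g : Bool → PTransition S Act → ℝ≥0∞ := fun i tr =>
    if h : tr ∈ A then ENNReal.ofReal (M.layerFlow R A a f i ⟨tr, h⟩) else 0
  have hg : ∀ i (tr : A), g i tr = ENNReal.ofReal (M.layerFlow R A a f i tr) := by
    intro i tr
    simp [g]
  have hnn1 : ∀ v i (tr : A), 0 ≤ if tr.1.source = v then M.layerFlow R A a f i tr else 0 := by
    intro v i tr
    split_ifs
    · exact hf.layerFlow_nonneg i tr
    · rfl
  have hnn2 : ∀ v i (tr : A) j, 0 ≤ if nextLayer M.hidden j tr.1.action = i then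
      M.layerFlow R A a f j tr * (tr.1.target v).toReal else 0 := by
    intro v i tr j
    split_ifs
    · exact mul_nonneg (hf.layerFlow_nonneg j tr) ENNReal.toReal_nonneg
    · rfl
  refine (hf.scheduler hA).inducesAllowedWeak_of_flow hA t a g
    (fun i v => ENNReal.ofReal (M.layerOutflow R A a f i v)) hf.stopPMF
    (fun _ _ => ENNReal.ofReal_ne_top) ?_ ?_ ?_ ?_ ?_
  · intro i v
    have h := hf.isLayerFlow.conservation i v
    rw [layerOutflow, ← h, ENNReal.ofReal_add (by split_ifs <;> simp)
      (Finset.sum_nonneg fun tr _ => Finset.sum_nonneg fun j _ => hnn2 v i tr j),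
      ENNReal.ofReal_sum_of_nonneg fun tr _ => Finset.sum_nonneg fun j _ => hnn2 v i tr j,
      ← Finset.sum_coe_sort A]
    congr 1
    · split_ifs <;> simp
    · refine Finset.sum_congr rfl fun tr _ => ?_
      rw [ENNReal.ofReal_sum_of_nonneg fun j _ => hnn2 v i tr j]
      refine Finset.sum_congr rfl fun j _ => ?_
      split_ifs
      · rw [hg, ENNReal.ofReal_mul (hf.layerFlow_nonneg j tr),
          ENNReal.ofReal_toReal (tr.1.target.apply_ne_top v)]
      · simp
  · intro i v
    rw [layerOutflow, ENNReal.ofReal_add (Finset.sum_nonneg fun tr _ => hnn1 v i tr)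
      (by split_ifs; exacts [hf.isLayerFlow.outlet_nonneg v, le_rfl]),
      ENNReal.ofReal_sum_of_nonneg fun tr _ => hnn1 v i tr, Finset.sum_filter,
      ← Finset.sum_coe_sort A]
    congr 1
    · refine Finset.sum_congr rfl fun tr _ => ?_
      split_ifs
      · rw [hg]
      · simp
    · split_ifs
      · rw [hf.stopPMF_apply]
      · simp
  · intro α tr h
    obtain ⟨_, h⟩ := hchoice α tr h
    exact (flowChoice_ne_zero h).1
  · intro α tr i hα hi htr hs
    have h1 : (hf.scheduler hA).choice α tr =
        ENNReal.ofReal (M.flowChoice R A t a f ⟨α, hα⟩ tr) := dif_pos hα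
    rw [h1, hf.flowChoice_eq (α := ⟨α, hα⟩) hi htr hs, hg i ⟨tr, htr⟩,
      ← ENNReal.ofReal_mul (div_nonneg (hf.layerFlow_nonneg _ _) (hf.layerOutflow_nonneg _ _))]
    by_cases h0 : M.layerOutflow R A a f i α.last = 0
    · rw [hf.layerFlow_eq_zero (tr := ⟨tr, htr⟩) (by rw [hs, h0])]
      simp
    · rw [div_mul_cancel₀ _ h0]
  · intro α tr h
    obtain ⟨_, h⟩ := hchoice α tr h
    exact (flowChoice_ne_zero h).2.2

end

/-- A scheduler that induces an allowed weak transition to a related distribution gives a feasible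
solution. -/
theorem exists_lpFeasible [Fintype S] {μ ν : PMF S} (hA : A ⊆ M.trans) {σ : M.Scheduler}
    (hσ : σ.InducesAllowedWeak A t a ν) (hν : LiftRel R.r μ ν) :
    ∃ f : NetVertex R A → NetVertex R A → ℝ, M.LPFeasible R A t a μ f := by
  obtain ⟨g, hg⟩ := hσ.exists_isLayerFlow hA
  exact ⟨_, hg.lpFeasible ((liftRel_iff_sum_eq_classProb R μ ν).1 hν)⟩

end ProbAutomaton

theorem mainTheorem2 {S Act : Type*} [Fintype S] (M : ProbAutomaton S Act) (R : Setoid S)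
    (a : Act) (μ : PMF S) (A : Finset (PTransition S Act)) (hA : A ⊆ M.trans) (t : S) :
    ((∃ f : NetVertex R A → NetVertex R A → ℝ, M.LPFeasible R A t a μ f ∧
        ∀ C : Quotient R, f (.cls C) .sink = ProbAutomaton.classProb μ C) ↔
      ∃ (σ : M.Scheduler) (ν : PMF S), σ.InducesAllowedWeak A t a ν ∧ LiftRel R.r μ ν) ∧
    ((∃ f : NetVertex R A → NetVertex R A → ℝ, M.LPOptimal R A t a μ f ∧
        ∀ C : Quotient R, f (.cls C) .sink = ProbAutomaton.classProb μ C) ↔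
      ∃ (σ : M.Scheduler) (ν : PMF S), σ.InducesAllowedWeak A t a ν ∧ LiftRel R.r μ ν) ∧
    (∀ f : NetVertex R A → NetVertex R A → ℝ, M.LPFeasible R A t a μ f →
      (∀ C : Quotient R, f (.cls C) .sink = ProbAutomaton.classProb μ C) →
      ∃ (σ : M.Scheduler) (ν : PMF S), σ.IsBuiltFrom R A t a f ∧ σ.Determinate ∧
        (∀ v : S, ν v = ENNReal.ofReal (M.stopFlow R A a f v)) ∧
        σ.InducesAllowedWeak A t a ν ∧ LiftRel R.r μ ν) := by
  refine ⟨⟨?_, ?_⟩, ⟨?_, ?_⟩, ?_⟩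
  -- The class condition can be dropped here and recovered below, since feasibility already contains
  -- it as `class_eq`.
  · rintro ⟨f, hf, -⟩
    exact ⟨_, _, hf.inducesAllowedWeak hA, hf.liftRel_stopPMF⟩
  · rintro ⟨σ, ν, hσ, hν⟩
    obtain ⟨f, hf⟩ := ProbAutomaton.exists_lpFeasible hA hσ hν
    exact ⟨f, hf, hf.class_eq⟩
  · rintro ⟨f, hf, -⟩
    exact ⟨_, _, hf.1.inducesAllowedWeak hA, hf.1.liftRel_stopPMF⟩
  · rintro ⟨σ, ν, hσ, hν⟩
    obtain ⟨f₀, hf₀⟩ := ProbAutomaton.exists_lpFeasible hA hσ hν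
    obtain ⟨f, hf⟩ := hf₀.exists_lpOptimal
    exact ⟨f, hf, hf.1.class_eq⟩
  · intro f hf _
    exact ⟨hf.scheduler hA, hf.stopPMF, fun _ _ => rfl, hf.determinate_scheduler hA,
      hf.stopPMF_apply, hf.inducesAllowedWeak hA, hf.liftRel_stopPMF⟩
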